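/- Let $(p_n)_{n\ge 1}$ be a strictly increasing sequence of primes such that, for every $n\ge 1$, $2^n$ divides $p_n-1$ and $p_{n+1}>2^n\,p_1p_2\cdots p_n$, and for every $n\geq 1$ let $\zeta_n$ be an element of order $2^n$ in $\mathbb F_{p_n}^*$. Such sequences exist. Let $V_m$ be the additive group of $\mathbb F_{p_m}$ and let $H_n=\langle x_n\rangle$ be a cyclic group of order $2^n$; for $m\le n$ let $x_n$ act on $V_m$ as multiplication by $\zeta_m$. Put $$G_n=(V_1\times\cdots\times V_n)\rtimes H_n ,\qquad G=\varprojlim_n G_n ,$$ where the map $G_{n+1}\to G_n$ forgets the factor $V_{n+1}$ and sends $x_{n+1}$ to $x_n$. For a finitely generated profinite group $G$ let $\tilde\beta_n(G)$ be the number of conjugacy classes of open subgroups $H$ of $G$ with $|G:H|\le n$ and $\mu(H,G)\ne 0$, where $\mu$ is the Möbius function of the lattice of open subgroups of $G$ (so $\mu(G,G)=1$ and $\sum_{H\le K\le G}\mu(K,G)=0$ for every proper open subgroup $H$), and let $\tilde\gamma_n(G)$ be the number of conjugacy classes of open subgroups $H$ with $|G:H|\le n$ that are intersections of maximal subgroups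 of $G$ ($G$ itself being the empty intersection). Then, for every choice of the sequences $(p_n)$ and $(\zeta_n)$ as above, $G$ is a prosupersolvable group that is topologically generated by two elements; $G\cong\bigl(\prod_{i\ge1}V_i\bigr)\rtimes\mathbb Z_2$ as topological groups, where $\mathbb Z_2$ is the group of $2$-adic integers and $1\in\mathbb Z_2$ acts on $V_i$ as multiplication by $\zeta_i$; $G$ has only finitely many open subgroups of index at most $n$, for every $n$; and $$\liminf_{n\to\infty}\frac{\tilde\beta_n(G)}{\tilde\gamma_n(G)}=0 .$$ -/

import Mathlib

open Filter Topology
open scoped ENNReal Pointwise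

namespace MaxInter

/-! ### Open subgroups of compact groups: Möbius function, maximal intersections, counting -/

section Counting

variable (G : Type*) [Group G] [TopologicalSpace G] [IsTopologicalGroup G] [CompactSpace G]

/-- Only finitely many subgroups lie between an open subgroup of a compact group and a further
open subgroup. -/
theorem finite_Icc_openSubgroup (H K : OpenSubgroup G) : (Set.Icc H K).Finite := by
  have : Finite (G ⧸ H.toSubgroup) := H.toSubgroup.quotient_finite_of_isOpen H.isOpen'
  refine Set.Finite.of_finite_image (f := fun L : OpenSubgroup G =>
    (QuotientGroup.mk (s := H.toSubgroup)) '' (L : Set G)) (Set.toFinite _) ?_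
  have key : ∀ L₁ ∈ Set.Icc H K, ∀ L₂ ∈ Set.Icc H K,
      (QuotientGroup.mk (s := H.toSubgroup)) '' (L₁ : Set G) =
        (QuotientGroup.mk (s := H.toSubgroup)) '' (L₂ : Set G) → L₁ ≤ L₂ := by
    intro L₁ _ L₂ h₂ h x hx
    have hx' : (QuotientGroup.mk x : G ⧸ H.toSubgroup) ∈
        (QuotientGroup.mk (s := H.toSubgroup)) '' (L₂ : Set G) := h ▸ ⟨x, hx, rfl⟩
    obtain ⟨y, hy, hyx⟩ := hx'
    have hmem : y⁻¹ * x ∈ H := QuotientGroup.eq.1 hyx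
    have := mul_mem (show y ∈ L₂ from hy) (h₂.1 hmem)
    simpa using this
  intro L₁ h₁ L₂ h₂ h
  exact le_antisymm (key L₁ h₁ L₂ h₂ h) (key L₂ h₂ L₁ h₁ h.symm)

/-- The lattice of open subgroups of a compact group is locally finite. -/
noncomputable instance : LocallyFiniteOrder (OpenSubgroup G) :=
  LocallyFiniteOrder.ofFiniteIcc (finite_Icc_openSubgroup G)

variable {G}

open Classical in
/-- `μ(H, G)`: the Möbius function of the lattice of open subgroups of `G`. -/
noncomputable def moebius (H : OpenSubgroup G) : ℤ :=
  IncidenceAlgebra.mu ℤ H (⊤ : OpenSubgroup G)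

/-- `H` is an intersection of maximal subgroups of `G` (maximal among the proper open subgroups,
as usual for profinite groups).  The group `G` itself is the intersection of the empty family. -/
def IsMaximalIntersection (H : OpenSubgroup G) : Prop :=
  ∃ S : Set (OpenSubgroup G), (∀ M ∈ S, IsCoatom M) ∧ (H : Set G) = ⋂ M ∈ S, (M : Set G)

/-- The conjugacy class of an open subgroup. -/
def conjClass (H : OpenSubgroup G) : Set (OpenSubgroup G) :=
  {K | ∃ g : G, (K : Subgroup G) = MulAut.conj g • (H : Subgroup G)}

/-- The number of conjugacy classes of open subgroups of index at most `n` satisfying `P`. -/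
noncomputable def countClasses (P : OpenSubgroup G → Prop) (n : ℕ) : ℕ :=
  Set.ncard (conjClass '' {H : OpenSubgroup G | (H : Subgroup G).index ≤ n ∧ P H})

variable (G)

/-- Number of conjugacy classes of open subgroups of index `≤ n` with nonzero Möbius number. -/
noncomputable def betaTilde (n : ℕ) : ℕ :=
  countClasses (fun H : OpenSubgroup G => moebius H ≠ 0) n

/-- Number of conjugacy classes of open subgroups of index `≤ n` that are intersections of
maximal subgroups. -/
noncomputable def gammaTilde (n : ℕ) : ℕ :=
  countClasses (fun H : OpenSubgroup G => IsMaximalIntersection H) n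

end Counting

/-! ### Supersolvable, prosupersolvable and 2-generated groups -/

/-- `Q` has a finite series of normal subgroups of `Q`, from `1` to `Q`, with cyclic factors. -/
def IsSupersolvable (Q : Type*) [Group Q] : Prop :=
  ∃ (k : ℕ) (s : ℕ → Subgroup Q), s 0 = ⊥ ∧ s k = ⊤ ∧
    ∀ i < k, (s i).Normal ∧ ∃ g : Q, s (i + 1) = s i ⊔ Subgroup.zpowers g

/-- A profinite group all of whose (finite) quotients by open normal subgroups are
supersolvable. -/
structure IsProsupersolvable (G : Type*) [Group G] [TopologicalSpace G] : Prop where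
  isTopologicalGroup : IsTopologicalGroup G
  compactSpace : CompactSpace G
  t2Space : T2Space G
  totallyDisconnectedSpace : TotallyDisconnectedSpace G
  supersolvable_quotient : ∀ N : OpenNormalSubgroup G, IsSupersolvable (G ⧸ N.toSubgroup)

/-- `G` is topologically generated by two elements. -/
def IsTwoGenerated (G : Type*) [Group G] [TopologicalSpace G] : Prop :=
  ∃ a b : G, Dense (Subgroup.closure {a, b} : Set G)

/-! ### The construction -/

/-- The choices made in the construction, with indices shifted by one: `p i` and `ζ i` stand for
`p_{i+1}` and `ζ_{i+1}`. -/
structure Choices where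
  /-- the primes -/
  p : ℕ → ℕ
  prime : ∀ i, (p i).Prime
  strictMono : StrictMono p
  dvd : ∀ i, 2 ^ (i + 1) ∣ p i - 1
  growth : ∀ i, 2 ^ (i + 1) * ∏ j ∈ Finset.range (i + 1), p j < p (i + 1)
  /-- the roots of unity -/
  ζ : ∀ i, (ZMod (p i))ˣ
  orderOf_ζ : ∀ i, orderOf (ζ i) = 2 ^ (i + 1)

namespace Choices

variable (D : Choices)

instance (i : ℕ) : NeZero (D.p i) := ⟨(D.prime i).ne_zero⟩

/-- `V_{i+1}`: the field with `p i` elements, as a (discrete) multiplicative group. -/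
abbrev V (i : ℕ) : Type := Multiplicative (ZMod (D.p i))

/-- `H_n`, cyclic of order `2 ^ n`; the generator `x_n` is `Multiplicative.ofAdd 1`. -/
abbrev H (n : ℕ) : Type := Multiplicative (ZMod (2 ^ n))

/-- The homomorphism `H_{i+1} → (ZMod (p i))ˣ` that sends the generator to `ζ i`. -/
noncomputable def char (i : ℕ) : H (i + 1) →* (ZMod (D.p i))ˣ :=
  AddMonoidHom.toMultiplicativeLeft (ZMod.lift (2 ^ (i + 1))
    ⟨zmultiplesHom (Additive (ZMod (D.p i))ˣ) (Additive.ofMul (D.ζ i)), by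
      have h : D.ζ i ^ (2 ^ (i + 1)) = 1 := by rw [← D.orderOf_ζ i]; exact pow_orderOf_eq_one _
      rw [zmultiplesHom_apply, natCast_zsmul, ← ofMul_pow, h, ofMul_one]⟩)

theorem char_generator (i : ℕ) : D.char i (Multiplicative.ofAdd 1) = D.ζ i := by
  have h := ZMod.lift_coe (2 ^ (i + 1)) (⟨zmultiplesHom (Additive (ZMod (D.p i))ˣ)
    (Additive.ofMul (D.ζ i)), by
      have h : D.ζ i ^ (2 ^ (i + 1)) = 1 := by rw [← D.orderOf_ζ i]; exact pow_orderOf_eq_one _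
      rw [zmultiplesHom_apply, natCast_zsmul, ← ofMul_pow, h, ofMul_one]⟩ :
    {f : ℤ →+ Additive (ZMod (D.p i))ˣ // f ((2 ^ (i + 1) : ℕ) : ℤ) = 0}) 1
  simp only [Int.cast_one, zmultiplesHom_apply, one_zsmul] at h
  exact congrArg Additive.toMul h

/-- A group `K` acting on a product of groups `ZMod (q i)` by multiplication with the value of
a character `χ i` on the `i`-th factor. -/
def diagonal {ι K : Type*} [Group K] (q : ι → ℕ) (χ : ∀ i, K →* (ZMod (q i))ˣ) :
    K →* MulAut (∀ i, Multiplicative (ZMod (q i))) where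
  toFun k :=
    { toFun := fun v i => Multiplicative.ofAdd ((χ i k : ZMod (q i)) * (v i).toAdd)
      invFun := fun v i => Multiplicative.ofAdd (((χ i k)⁻¹ : (ZMod (q i))ˣ) * (v i).toAdd)
      left_inv := fun v => by ext i; simp
      right_inv := fun v => by ext i; simp
      map_mul' := fun v w => by funext i; simp [mul_add] }
  map_one' := by ext v i; simp
  map_mul' k l := by ext v i; simp [mul_assoc]

/-- Reduction `H_m → H_n` for `n ≤ m`, sending `x_m` to `x_n`. -/
def red {n m : ℕ} (h : n ≤ m) : H m →* H n :=
  AddMonoidHom.toMultiplicative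
    (ZMod.castHom (pow_dvd_pow 2 h) (ZMod (2 ^ n))).toAddMonoidHom

/-- The action of `H_n` on `V_1 × ⋯ × V_n`: the generator acts on `V_{i+1}` as `ζ i`. -/
noncomputable def actFin (n : ℕ) : H n →* MulAut (∀ i : Fin n, D.V i) :=
  diagonal (fun i : Fin n => D.p i) fun i => (D.char i).comp (red (Nat.succ_le_of_lt i.2))

/-- `G_n = (V_1 × ⋯ × V_n) ⋊ H_n`, a finite group. -/
abbrev Gn (n : ℕ) : Type := (∀ i : Fin n, D.V i) ⋊[D.actFin n] H n

instance (n : ℕ) : TopologicalSpace (D.Gn n) := ⊥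

instance (n : ℕ) : DiscreteTopology (D.Gn n) := ⟨rfl⟩

instance (n : ℕ) : Finite (D.Gn n) :=
  Finite.of_equiv _ (SemidirectProduct.equivProd (φ := D.actFin n)).symm

theorem red_red {l n m : ℕ} (h : l ≤ n) (h' : n ≤ m) (x : H m) :
    red h (red h' x) = red (h.trans h') x := by
  refine congrArg Multiplicative.ofAdd ?_
  exact RingHom.congr_fun (RingHom.ext_zmod ((ZMod.castHom (pow_dvd_pow 2 h) (ZMod (2 ^ l))).comp
    (ZMod.castHom (pow_dvd_pow 2 h') (ZMod (2 ^ n))))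
    (ZMod.castHom (pow_dvd_pow 2 (h.trans h')) (ZMod (2 ^ l)))) x.toAdd

/-- The epimorphism `G_{n+1} → G_n` that forgets the factor `V_{n+1}` and reduces `H_{n+1}` to
`H_n`. -/
noncomputable def transition (n : ℕ) : D.Gn (n + 1) →* D.Gn n :=
  SemidirectProduct.map
    (MonoidHom.mk' (fun (v : ∀ i : Fin (n + 1), D.V i) (i : Fin n) => v i.castSucc)
      fun _ _ => rfl)
    (red n.le_succ) (by
      intro x
      refine MonoidHom.ext fun v => funext fun i => ?_
      refine congrArg (fun y => Multiplicative.ofAdd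
        ((D.char i y : ZMod (D.p i)) * (show ZMod (D.p i) from (v i.castSucc).toAdd))) ?_
      exact (red_red _ _ x).symm)

/-- The inverse limit of the groups `G_n`, as a subgroup of their product. -/
noncomputable def limitSubgroup : Subgroup (∀ n, D.Gn n) where
  carrier := {g | ∀ n, D.transition n (g (n + 1)) = g n}
  one_mem' := fun n => by simp
  mul_mem' := fun ha hb n => by simp [ha n, hb n]
  inv_mem' := fun ha n => by simp [ha n]

/-- The group `G`, the inverse limit of the `G_n`, with the subspace topology of the product
topology. -/
abbrev G : Type := D.limitSubgroup

instance : CompactSpace D.G := by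
  apply isCompact_iff_compactSpace.1
  apply IsClosed.isCompact
  have : (D.limitSubgroup : Set (∀ n, D.Gn n)) =
      ⋂ n, {g | D.transition n (g (n + 1)) = g n} := by
    ext g; simp [limitSubgroup]
  rw [this]
  exact isClosed_iInter fun n => isClosed_eq
    (continuous_of_discreteTopology.comp (continuous_apply (n + 1))) (continuous_apply n)

/-- The action of the 2-adic integers on `∏ V_i`: `1` acts on `V_{i+1}` as `ζ i`, and
the action on `V_{i+1}` factors through the residues modulo `2 ^ (i + 1)`. -/
noncomputable def actPadic : Multiplicative ℤ_[2] →* MulAut (∀ i : ℕ, D.V i) :=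
  diagonal D.p fun i => (D.char i).comp
    (AddMonoidHom.toMultiplicative (PadicInt.toZModPow (p := 2) (i + 1)).toAddMonoidHom)

/-- `(∏ V_i) ⋊ ℤ_2`. -/
abbrev Semi : Type := (∀ i : ℕ, D.V i) ⋊[D.actPadic] Multiplicative ℤ_[2]

/-- The product topology on `(∏ V_i) ⋊ ℤ_2`. -/
noncomputable instance : TopologicalSpace D.Semi :=
  TopologicalSpace.induced (SemidirectProduct.equivProd (φ := D.actPadic)) inferInstance

end Choices

end MaxInter

/-! Write `E` for the proper open normal subgroup `even`. Identify the limit with `(∏ V_i) ⋊ ℤ_2`,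
acting on each line `V_i` by affine maps. A maximal open subgroup not inside `E` is the stabilizer
of a point of some `V_i`, of index `p i` (`exists_eq_stab`). An affine map fixing two points of
`V_i` is the identity there, so two such stabilizers for the same `i` intersect inside `E`.

Upper bound for `betaTilde`: by Weisner's theorem at `E`, a subgroup with nonzero Möbius number is
`X` or `X ⊓ E`, where `X` is an intersection of maximal subgroups and is not inside `E`. Such an `X`
uses at most one point in each `V_i`, and one translation moves all these points to 0. Up to
conjugacy only a set of indices and one bit remain: at most `2 ^ (N + 1)` classes when the index is
below `p N` (`betaTilde_le`).

Lower bound for `gammaTilde`: fixing 0 in every `V_i` with `i ∈ C`, and also a second point in one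
`V_t` with `t ∈ C`, shrinks the 2-adic part to `2 ^ (t + 1) ℤ_2`. Both `t` and `C` are conjugacy
invariants, so there are at least `N * 2 ^ (N - 1)` classes of index at most `2 ^ N * ∏_{i < N} p i`
(`le_gammaTilde`).

The growth condition puts this last number below `p N`, so the ratio is at most `4 / N` there. -/

namespace MaxInter

/-! ### Möbius functions of locally finite meet-semilattices -/

section Moebius

open Finset IncidenceAlgebra

variable {α : Type*} [SemilatticeInf α] [OrderTop α] [LocallyFiniteOrder α] [DecidableEq α]

/-- Weisner's theorem. -/
theorem sum_mu_inf_eq {a h : α} (hha : h ≤ a) (ha : a ≠ ⊤) :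
    ∑ x ∈ (Icc h ⊤) with x ⊓ a = h, mu ℤ x ⊤ = 0 := by
  induction hn : #(Icc h (⊤ : α)) using Nat.strong_induction_on generalizing h with
  | _ n ih =>
    have hmaps : ∀ x ∈ Icc h (⊤ : α), x ⊓ a ∈ Icc h a := fun x hx =>
      mem_Icc.2 ⟨le_inf (mem_Icc.1 hx).1 hha, inf_le_right⟩
    -- The Möbius numbers on `[h, ⊤]` sum to 0. Group them by `x ⊓ a`: the fibre over `y ≠ h` is the
    -- same kind of sum for the shorter interval `[y, ⊤]`, so induction kills it.
    have htot := sum_Icc_mu_left (𝕜 := ℤ) h (⊤ : α)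
    rw [if_neg (fun e : h = ⊤ => ha (top_le_iff.1 (e ▸ hha))), ← sum_fiberwise_of_maps_to hmaps,
      sum_eq_single_of_mem h (left_mem_Icc.2 hha)] at htot
    · exact htot
    intro y hy hyh
    obtain ⟨hy₁, hy₂⟩ := mem_Icc.1 hy
    have hlt : h < y := lt_of_le_of_ne hy₁ (Ne.symm hyh)
    have hset : ((Icc h (⊤ : α)).filter fun x => x ⊓ a = y) =
        (Icc y (⊤ : α)).filter fun x => x ⊓ a = y := by
      ext x
      simp only [mem_filter, mem_Icc, le_top, and_true]
      exact ⟨fun hx => ⟨hx.2 ▸ inf_le_left, hx.2⟩, fun hx => ⟨hy₁.trans hx.1, hx.2⟩⟩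
    rw [hset]
    exact ih _ (hn ▸ card_lt_card (Icc_ssubset_Icc_left le_top hlt le_rfl)) hy₂ rfl

open Classical in
/-- An element with nonzero Möbius number is the infimum of the coatoms above it. -/
theorem inf_coatoms_eq_of_mu_ne_zero {h : α} (hmu : mu ℤ h ⊤ ≠ 0) :
    ((Icc h (⊤ : α)).filter IsCoatom).inf id = h := by
  induction hn : #(Icc h (⊤ : α)) using Nat.strong_induction_on generalizing h with
  | _ n ih =>
    set c := ((Icc h (⊤ : α)).filter IsCoatom).inf id with hc
    have hle : h ≤ c := Finset.le_inf fun x hx => (mem_Icc.1 (mem_filter.1 hx).1).1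
    by_contra hne
    have hlt : h < c := lt_of_le_of_ne hle (Ne.symm hne)
    have hhtop : h < ⊤ := lt_of_lt_of_le hlt le_top
    have hctop : c ≠ ⊤ := by
      obtain ⟨m, hm⟩ := (Ico h (⊤ : α)).exists_maximal ⟨h, left_mem_Ico.2 hhtop⟩
      have hm' := mem_Ico.1 hm.1
      have hco : IsCoatom m := ⟨hm'.2.ne, fun b hb => by
        by_contra hbt
        exact hb.not_ge (hm.2 (mem_Ico.2 ⟨hm'.1.trans hb.le, lt_top_iff_ne_top.2 hbt⟩) hb.le)⟩
      have : c ≤ m := Finset.inf_le (f := id)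
        (mem_filter.2 ⟨mem_Icc.2 ⟨hm'.1, le_top⟩, hco⟩)
      exact fun e => hco.1 (top_le_iff.1 (e ▸ this))
    -- By induction, an `x > h` with nonzero Möbius number is a meet of coatoms above `h`, so `c ≤
    -- x`. The total over `[h, ⊤]` thus reduces to `h` and `[c, ⊤]`; the latter contributes 0
    -- because `c ≠ ⊤`.
    have htot := sum_Icc_mu_left (𝕜 := ℤ) h (⊤ : α)
    have hsub : insert h (Icc c (⊤ : α)) ⊆ Icc h ⊤ := by
      intro x hx
      rcases mem_insert.1 hx with rfl | hx
      · exact left_mem_Icc.2 le_top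
      · exact mem_Icc.2 ⟨hle.trans (mem_Icc.1 hx).1, le_top⟩
    rw [if_neg hhtop.ne, ← sum_subset hsub, sum_insert, sum_Icc_mu_left, if_neg hctop,
      add_zero] at htot
    · exact hmu htot
    · exact fun hx => hlt.not_ge (mem_Icc.1 hx).1
    · intro x hx hx'
      by_contra hxmu
      have hhx := (mem_Icc.1 hx).1
      have hlt' : h < x := lt_of_le_of_ne hhx fun e => hx' (mem_insert.2 (Or.inl e.symm))
      have hxc := ih _ (hn ▸ card_lt_card (Icc_ssubset_Icc_left le_top hlt' le_rfl)) hxmu rfl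
      refine hx' (mem_insert_of_mem (mem_Icc.2 ⟨?_, le_top⟩))
      rw [← hxc]
      exact inf_mono (filter_subset_filter _ (Icc_subset_Icc_left hhx))

end Moebius

/-! ### Möbius numbers and maximal subgroups of compact groups -/

section OpenSubgroups

variable {G : Type*} [Group G] [TopologicalSpace G]

theorem OpenSubgroup.coe_finset_inf {ι : Type*} (s : Finset ι) (f : ι → OpenSubgroup G) :
    ((s.inf f : OpenSubgroup G) : Set G) = ⋂ i ∈ s, (f i : Set G) := by
  classical
  induction s using Finset.induction_on with
  | empty => simp
  | insert a s has ih => rw [Finset.inf_insert, OpenSubgroup.coe_inf, ih, Finset.set_biInter_insert]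

theorem Subgroup.isCoatom_of_prime_index {G : Type*} [Group G] {M : Subgroup G}
    (hM : M.index.Prime) : IsCoatom M := by
  refine ⟨fun e => hM.ne_one (by rw [e]; exact Subgroup.index_top), fun K hK => ?_⟩
  have hmul := Subgroup.relIndex_mul_index hK.le
  rcases (Nat.dvd_prime hM).1 (Dvd.intro_left _ hmul) with h | h
  · exact Subgroup.index_eq_one.1 h
  · rw [h] at hmul
    have : M.relIndex K = 1 := Nat.eq_of_mul_eq_mul_right hM.pos (hmul.trans (one_mul _).symm)
    exact absurd (Subgroup.relIndex_eq_one.1 this) hK.not_ge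

theorem isCoatom_of_prime_index {M : OpenSubgroup G} (hM : (M : Subgroup G).index.Prime) :
    IsCoatom M := by
  have h := Subgroup.isCoatom_of_prime_index hM
  exact ⟨fun e => h.1 (congrArg OpenSubgroup.toSubgroup e),
    fun K hK => OpenSubgroup.toSubgroup_injective (h.2 K hK)⟩

variable [IsTopologicalGroup G]

theorem isCoatom_toSubgroup {M : OpenSubgroup G} (hM : IsCoatom M) :
    IsCoatom (M : Subgroup G) := by
  refine ⟨fun e => hM.1 (OpenSubgroup.toSubgroup_injective e), fun K hK => ?_⟩
  have h := hM.2 ⟨K, Subgroup.isOpen_mono hK.le M.isOpen⟩ hK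
  exact congrArg OpenSubgroup.toSubgroup h

variable [CompactSpace G]

theorem isMaximalIntersection_of_moebius_ne_zero {H : OpenSubgroup G} (hH : moebius H ≠ 0) :
    IsMaximalIntersection H := by
  classical
  refine ⟨{M | M ∈ (Finset.Icc H ⊤).filter IsCoatom},
    fun M hM => (Finset.mem_filter.1 hM).2, ?_⟩
  have h := inf_coatoms_eq_of_mu_ne_zero hH
  conv_lhs => rw [← h, OpenSubgroup.coe_finset_inf]
  simp

/-- Relative to a proper open subgroup `A`, an open subgroup with nonzero Möbius number is either
an intersection of maximal subgroups not contained in `A`, or the intersection of `A` with such a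
subgroup. -/
theorem exists_isMaximalIntersection_of_moebius_ne_zero {H A : OpenSubgroup G} (hA : A ≠ ⊤)
    (hH : moebius H ≠ 0) :
    ∃ X : OpenSubgroup G, IsMaximalIntersection X ∧ ¬ X ≤ A ∧ (H = X ∨ H = X ⊓ A) := by
  classical
  by_cases hHA : H ≤ A
  · have hsum := sum_mu_inf_eq hHA hA
    have hmem : H ∈ (Finset.Icc H ⊤).filter fun x => x ⊓ A = H :=
      Finset.mem_filter.2 ⟨Finset.left_mem_Icc.2 le_top, inf_eq_left.2 hHA⟩
    -- Weisner's sum vanishes but contains the nonzero term of `H`, so some other term is nonzero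
    -- too.
    obtain ⟨X, hX, hXH, hXmu⟩ :
        ∃ X ∈ (Finset.Icc H ⊤).filter (fun x => x ⊓ A = H), X ≠ H ∧
          IncidenceAlgebra.mu ℤ X ⊤ ≠ 0 := by
      by_contra! hcon
      rw [Finset.sum_eq_single_of_mem H hmem hcon] at hsum
      exact hH (by unfold moebius; convert hsum)
    have hXA := (Finset.mem_filter.1 hX).2
    refine ⟨X, isMaximalIntersection_of_moebius_ne_zero (by unfold moebius; convert hXmu),
      fun hle => hXH ?_, Or.inr hXA.symm⟩
    rw [← hXA, inf_eq_left.2 hle]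
  · exact ⟨H, isMaximalIntersection_of_moebius_ne_zero hH, hHA, Or.inl rfl⟩

end OpenSubgroups

end MaxInter
-- Existence of the choices, and the limit as a semidirect product
namespace MaxInter

theorem continuous_toZModPow (n : ℕ) :
    Continuous (PadicInt.toZModPow (p := 2) n : ℤ_[2] → ZMod (2 ^ n)) := by
  refine continuous_of_continuousAt_zero (PadicInt.toZModPow (p := 2) n) ?_
  refine tendsto_nhds_of_eventually_eq ?_
  filter_upwards [Metric.ball_mem_nhds (0 : ℤ_[2]) (ε := (2 : ℝ) ^ (-n : ℤ)) (by positivity)]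
    with x hx
  rw [mem_ball_zero_iff] at hx
  have hmem := (PadicInt.norm_le_pow_iff_mem_span_pow x n).1 (by exact_mod_cast hx.le)
  rw [← PadicInt.ker_toZModPow] at hmem
  rw [map_zero]
  exact hmem

/-- By compactness of `ℤ_2`: the residue classes of the `a n` form a decreasing sequence of nonempty
closed sets. -/
theorem exists_padicInt_of_compatible (a : ∀ n, ZMod (2 ^ n))
    (ha : ∀ n, ZMod.castHom (pow_dvd_pow 2 n.le_succ) (ZMod (2 ^ n)) (a (n + 1)) = a n) :
    ∃ z : ℤ_[2], ∀ n, PadicInt.toZModPow n z = a n := by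
  have hclosed : ∀ n, IsClosed {z : ℤ_[2] | PadicInt.toZModPow n z = a n} := fun n =>
    isClosed_eq (continuous_toZModPow n) continuous_const
  obtain ⟨z, hz⟩ := IsCompact.nonempty_iInter_of_sequence_nonempty_isCompact_isClosed
    (fun n => {z : ℤ_[2] | PadicInt.toZModPow n z = a n})
    (fun n z hz => by
      have hz' : PadicInt.toZModPow (n + 1) z = a (n + 1) := hz
      have := RingHom.congr_fun (PadicInt.zmod_cast_comp_toZModPow (p := 2) n (n + 1) n.le_succ) z
      rw [RingHom.comp_apply, hz', ha] at this
      exact this.symm)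
    (fun n => ZMod.ringHom_surjective (PadicInt.toZModPow n) (a n))
    (hclosed 0).isCompact hclosed
  exact ⟨z, fun n => Set.mem_iInter.1 hz n⟩

namespace Choices

/-- One step of the construction of the primes: a pair consisting of the last prime and of the
product of the primes found so far is extended by a further prime. -/
theorem exists_next_prime (i P : ℕ) :
    ∃ q : ℕ, q.Prime ∧ 2 ^ (i + 1) ∣ q - 1 ∧ 2 ^ i * P < q := by
  obtain ⟨q, hq, hlt, hmod⟩ := Nat.exists_prime_gt_modEq_one (k := 2 ^ (i + 1)) (2 ^ i * P)
    (by positivity)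
  exact ⟨q, hq, (Nat.modEq_iff_dvd' hq.one_lt.le).1 hmod.symm, hlt⟩

theorem exists_primes :
    ∃ p : ℕ → ℕ, (∀ i, (p i).Prime) ∧ (∀ i, 2 ^ (i + 1) ∣ p i - 1) ∧
      ∀ i, 2 ^ (i + 1) * ∏ j ∈ Finset.range (i + 1), p j < p (i + 1) := by
  choose next hprime hdvd hlt using exists_next_prime
  -- `P n` is the product of the first `n` primes chosen; the prime with index `n` is then `next n
  -- (P n)`.
  let P : ℕ → ℕ := fun n => Nat.rec 1 (fun i Q => Q * next i Q) n
  have hP : ∀ n, P n = ∏ j ∈ Finset.range n, next j (P j) := by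
    intro n
    induction n with
    | zero => rfl
    | succ n ih => rw [Finset.prod_range_succ, ← ih]
  refine ⟨fun i => next i (P i), fun i => hprime _ _, fun i => hdvd _ _, fun i => ?_⟩
  rw [← hP]
  exact hlt _ _

theorem nonempty : Nonempty Choices := by
  obtain ⟨p, hp, hdvd, hlt⟩ := exists_primes
  have hζ : ∀ i, ∃ z : (ZMod (p i))ˣ, orderOf z = 2 ^ (i + 1) := by
    intro i
    have := Fact.mk (hp i)
    obtain ⟨g, hg⟩ := IsCyclic.exists_ofOrder_eq_natCard (α := (ZMod (p i))ˣ)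
    rw [Nat.card_eq_fintype_card, ZMod.card_units] at hg
    exact ⟨_, orderOf_pow_orderOf_div (by rw [hg]; have := (hp i).two_le; omega)
      (hg ▸ hdvd i)⟩
  choose ζ hζ using hζ
  refine ⟨p, hp, strictMono_nat_of_lt_succ fun i => lt_of_le_of_lt ?_ (hlt i), hdvd, hlt, ζ, hζ⟩
  rw [Finset.prod_range_succ, ← mul_assoc]
  exact Nat.le_mul_of_pos_left _
    (Nat.mul_pos (by positivity) (Finset.prod_pos fun j _ => (hp j).pos))

variable (D : Choices)

theorem red_toZModPow {n m : ℕ} (h : n ≤ m) (z : ℤ_[2]) :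
    red h (Multiplicative.ofAdd (PadicInt.toZModPow (p := 2) m z)) =
      Multiplicative.ofAdd (PadicInt.toZModPow (p := 2) n z) :=
  congrArg Multiplicative.ofAdd
    (RingHom.congr_fun (PadicInt.zmod_cast_comp_toZModPow (p := 2) n m h) z)

/-- The projection `(∏ V_i) ⋊ ℤ_2 → G_n`. -/
noncomputable def toGn (n : ℕ) : D.Semi →* D.Gn n :=
  SemidirectProduct.map
    (MonoidHom.mk' (fun (v : ∀ i, D.V i) (i : Fin n) => v i) fun _ _ => rfl)
    (AddMonoidHom.toMultiplicative (PadicInt.toZModPow (p := 2) n).toAddMonoidHom) (by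
      intro x
      refine MonoidHom.ext fun v => funext fun i => ?_
      refine congrArg (fun y => Multiplicative.ofAdd
        ((D.char i y : ZMod (D.p i)) * (show ZMod (D.p i) from (v i).toAdd))) ?_
      exact (red_toZModPow (Nat.succ_le_of_lt i.2) x.toAdd).symm)

theorem transition_toGn (n : ℕ) (s : D.Semi) : D.transition n (D.toGn (n + 1) s) = D.toGn n s :=
  SemidirectProduct.ext (funext fun _ => rfl) (red_toZModPow n.le_succ s.right.toAdd)

/-- The homeomorphism of `(∏ V_i) ⋊ ℤ_2` with the product space. -/
noncomputable def homeoProd : D.Semi ≃ₜ (∀ i, D.V i) × Multiplicative ℤ_[2] :=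
  (SemidirectProduct.equivProd (φ := D.actPadic)).toHomeomorphOfIsInducing ⟨rfl⟩

instance : CompactSpace D.Semi := D.homeoProd.symm.compactSpace

theorem continuous_toGn (n : ℕ) : Continuous (D.toGn n) := by
  have h₁ : Continuous fun q : (∀ i, D.V i) × Multiplicative ℤ_[2] =>
      ((fun i : Fin n => q.1 i, Multiplicative.ofAdd (PadicInt.toZModPow (p := 2) n q.2.toAdd)) :
        (∀ i : Fin n, D.V i) × H n) := by
    refine Continuous.prodMk (by fun_prop) ?_
    exact continuous_ofAdd.comp
      ((continuous_toZModPow n).comp (continuous_toAdd.comp continuous_snd))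
  have h₂ : Continuous (SemidirectProduct.equivProd (φ := D.actFin n)).symm :=
    continuous_of_discreteTopology
  exact h₂.comp (h₁.comp D.homeoProd.continuous)

/-- The homomorphism from `(∏ V_i) ⋊ ℤ_2` to the inverse limit of the groups `G_n`. -/
noncomputable def toLimit : D.Semi →* D.G :=
  (MonoidHom.mk' (fun s n => D.toGn n s) fun s t => funext fun n => map_mul (D.toGn n) s t :
    D.Semi →* ∀ n, D.Gn n).codRestrict D.limitSubgroup fun s n => D.transition_toGn n s

theorem coe_toLimit (s : D.Semi) (n : ℕ) : (D.toLimit s : ∀ n, D.Gn n) n = D.toGn n s := rfl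

theorem continuous_toLimit : Continuous D.toLimit :=
  Continuous.subtype_mk (continuous_pi fun n => D.continuous_toGn n) _

theorem toLimit_injective : Function.Injective D.toLimit := by
  intro s t h
  have h' : ∀ n, D.toGn n s = D.toGn n t := fun n => by rw [← coe_toLimit, h, coe_toLimit]
  refine SemidirectProduct.ext (funext fun i => ?_) ?_
  · exact congrArg (fun g : D.Gn (i + 1) => g.left (Fin.last i)) (h' (i + 1))
  · exact congrArg Multiplicative.ofAdd (PadicInt.ext_of_toZModPow.1 fun n =>
      congrArg (fun g : D.Gn n => g.right.toAdd) (h' n))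

/-- The transition maps keep coordinate `i`, so it may be read off at level `i + 1`, where it first
appears. -/
theorem left_eq_left_succ (g : D.G) (i : ℕ) {n : ℕ} (h : i < n) :
    ((g : ∀ n, D.Gn n) n).left ⟨i, h⟩ = ((g : ∀ n, D.Gn n) (i + 1)).left (Fin.last i) := by
  induction n, h using Nat.le_induction with
  | base => rfl
  | succ n hn ih =>
    rw [← ih]
    exact congrArg (fun x : D.Gn n => x.left ⟨i, hn⟩) (g.2 n)

theorem toLimit_surjective : Function.Surjective D.toLimit := by
  intro g
  obtain ⟨z, hz⟩ := exists_padicInt_of_compatible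
    (fun n => ((g : ∀ n, D.Gn n) n).right.toAdd) fun n =>
      congrArg (fun x : D.Gn n => x.right.toAdd) (g.2 n)
  refine ⟨⟨fun i => ((g : ∀ n, D.Gn n) (i + 1)).left (Fin.last i), Multiplicative.ofAdd z⟩,
    Subtype.ext (funext fun n => SemidirectProduct.ext (funext fun i => ?_) ?_)⟩
  · exact (D.left_eq_left_succ g i i.2).symm
  · exact congrArg Multiplicative.ofAdd (hz n)

/-- The inverse limit of the groups `G_n` is `(∏ V_i) ⋊ ℤ_2`. -/
noncomputable def semiEquiv : D.Semi ≃ₜ* D.G :=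
  let E := MulEquiv.ofBijective D.toLimit ⟨D.toLimit_injective, D.toLimit_surjective⟩
  { E with
    continuous_toFun := D.continuous_toLimit
    continuous_invFun :=
      (Continuous.homeoOfEquivCompactToT2 (f := E.toEquiv) D.continuous_toLimit).continuous_symm }

/-- Transported from the limit, which inherits it from a product of discrete groups. -/
instance : IsTopologicalGroup D.Semi :=
  D.semiEquiv.toHomeomorph.isInducing.topologicalGroup D.semiEquiv

end Choices

end MaxInter
-- The affine actions on the `V_i` and their point stabilizers
namespace MaxInter

namespace Choices

theorem isUnit_of_toZModPow_one_ne_zero {z : ℤ_[2]} (hz : PadicInt.toZModPow 1 z ≠ 0) :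
    IsUnit z := by
  rw [PadicInt.isUnit_iff]
  by_contra hne
  have hlt : ‖z‖ < 1 := lt_of_le_of_ne (PadicInt.norm_le_one z) hne
  refine hz ?_
  rw [← RingHom.mem_ker, PadicInt.ker_toZModPow, pow_one, Ideal.mem_span_singleton]
  exact (PadicInt.norm_lt_one_iff_dvd z).1 hlt

/-- Up to a unit, `d` is a power of 2. This makes the ideal of multiples of `d` open. -/
theorem exists_dvd_of_toZModPow_eq_zero {d : ℤ_[2]} (hd : d ≠ 0) :
    ∃ k, ∀ z : ℤ_[2], PadicInt.toZModPow k z = 0 → d ∣ z := by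
  refine ⟨d.valuation, fun z hz => ?_⟩
  rw [← RingHom.mem_ker, PadicInt.ker_toZModPow, Ideal.mem_span_singleton] at hz
  rw [PadicInt.unitCoeff_spec hd]
  exact (Units.mul_left_dvd).2 hz

variable (D : Choices)

theorem fact_prime (i : ℕ) : Fact (D.p i).Prime := ⟨D.prime i⟩

attribute [local instance] fact_prime

/-- The character by which `ℤ_2` acts on `V_{i+1}`. -/
noncomputable def padicChar (i : ℕ) : Multiplicative ℤ_[2] →* (ZMod (D.p i))ˣ :=
  (D.char i).comp
    (AddMonoidHom.toMultiplicative (PadicInt.toZModPow (p := 2) (i + 1)).toAddMonoidHom)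

theorem char_eq_pow (i : ℕ) (x : H (i + 1)) : D.char i x = D.ζ i ^ x.toAdd.val := by
  rw [← char_generator, ← map_pow, ← ofAdd_nsmul, nsmul_one, ZMod.natCast_zmod_val, ofAdd_toAdd]

/-- The order of `ζ i` is exactly the order of `H (i + 1)`, so the character is faithful. -/
theorem char_eq_one_iff {i : ℕ} {x : H (i + 1)} : D.char i x = 1 ↔ x = 1 := by
  refine ⟨fun h => ?_, fun h => by rw [h, map_one]⟩
  rw [char_eq_pow, ← orderOf_dvd_iff_pow_eq_one, D.orderOf_ζ] at h
  have h0 := Nat.eq_zero_of_dvd_of_lt h (ZMod.val_lt x.toAdd)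
  exact congrArg Multiplicative.ofAdd ((ZMod.val_eq_zero _).1 h0)

theorem padicChar_eq_one_iff {i : ℕ} {z : Multiplicative ℤ_[2]} :
    D.padicChar i z = 1 ↔ PadicInt.toZModPow (i + 1) z.toAdd = 0 :=
  D.char_eq_one_iff

theorem padicChar_generator (i : ℕ) : D.padicChar i (Multiplicative.ofAdd 1) = D.ζ i := by
  rw [← char_generator]
  exact congrArg (fun y => D.char i (Multiplicative.ofAdd y))
    (map_one (PadicInt.toZModPow (p := 2) (i + 1)))

theorem toZModPow_one_eq_zero {n : ℕ} (z : ℤ_[2])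
    (hz : PadicInt.toZModPow (n + 1) z = 0) : PadicInt.toZModPow 1 z = 0 := by
  rw [← PadicInt.zmod_cast_comp_toZModPow (p := 2) 1 (n + 1) (Nat.succ_le_succ n.zero_le),
    RingHom.comp_apply, hz, map_zero]

/-- The coordinates of the translation part of an element of `(∏ V_i) ⋊ ℤ_2`. -/
def coord (i : ℕ) (s : D.Semi) : ZMod (D.p i) := (s.left i).toAdd

/-- The cocycle identity: it makes `x ↦ coord i s + padicChar i s.right * x` an action on `V_i`. -/
theorem coord_mul (i : ℕ) (s t : D.Semi) :
    D.coord i (s * t) = D.coord i s + D.padicChar i s.right * D.coord i t := rfl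

@[simp] theorem coord_one (i : ℕ) : D.coord i (1 : D.Semi) = 0 := rfl

@[simp] theorem coord_inl (i : ℕ) (w : ∀ i, D.V i) :
    D.coord i (SemidirectProduct.inl w) = (w i).toAdd := rfl

@[simp] theorem coord_inr (i : ℕ) (z : Multiplicative ℤ_[2]) :
    D.coord i (SemidirectProduct.inr z : D.Semi) = 0 := rfl

theorem coord_inv (i : ℕ) (s : D.Semi) :
    D.coord i s⁻¹ = -(D.padicChar i s.right⁻¹ * D.coord i s) := by
  have h := D.coord_mul i s⁻¹ s
  rw [inv_mul_cancel, coord_one, SemidirectProduct.inv_right] at h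
  exact eq_neg_of_add_eq_zero_left h.symm

theorem coord_conj (i : ℕ) (g : D.Semi) {s : D.Semi} (hs : s.right = 1) :
    D.coord i (g * s * g⁻¹) = D.padicChar i g.right * D.coord i s := by
  rw [coord_mul, coord_mul, coord_inv, SemidirectProduct.mul_right, hs, mul_one, mul_neg,
    ← mul_assoc, ← Units.val_mul, ← map_mul, mul_inv_cancel, map_one, Units.val_one]
  ring

theorem semi_ext {s t : D.Semi} (h : ∀ i, D.coord i s = D.coord i t) (h' : s.right = t.right) :
    s = t :=
  SemidirectProduct.ext (funext fun i => congrArg Multiplicative.ofAdd (h i)) h'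

theorem continuous_coord (i : ℕ) : Continuous (D.coord i) :=
  continuous_toAdd.comp
    ((continuous_apply i).comp (continuous_fst.comp D.homeoProd.continuous))

theorem continuous_right : Continuous fun s : D.Semi => s.right :=
  continuous_snd.comp D.homeoProd.continuous

theorem continuous_padicChar (i : ℕ) :
    Continuous fun z : Multiplicative ℤ_[2] => (D.padicChar i z : ZMod (D.p i)) :=
  (continuous_of_discreteTopology (f := fun x : ZMod (2 ^ (i + 1)) =>
    (D.char i (Multiplicative.ofAdd x) : ZMod (D.p i)))).comp
      ((continuous_toZModPow (i + 1)).comp continuous_toAdd)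

theorem continuous_inl :
    Continuous (SemidirectProduct.inl : (∀ i, D.V i) →* D.Semi) :=
  D.homeoProd.symm.continuous.comp (Continuous.prodMk continuous_id continuous_const)

theorem continuous_inr :
    Continuous (SemidirectProduct.inr : Multiplicative ℤ_[2] →* D.Semi) :=
  D.homeoProd.symm.continuous.comp (Continuous.prodMk continuous_const continuous_id)

/-- The subgroup `(∏ V_i) ⋊ 2ℤ_2`. -/
noncomputable def even : Subgroup D.Semi :=
  ((AddMonoidHom.toMultiplicative (PadicInt.toZModPow (p := 2) 1).toAddMonoidHom).comp
    SemidirectProduct.rightHom).ker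

theorem mem_even {s : D.Semi} : s ∈ D.even ↔ PadicInt.toZModPow 1 s.right.toAdd = 0 := Iff.rfl

instance : D.even.Normal := MonoidHom.normal_ker _

theorem isOpen_even : IsOpen (D.even : Set D.Semi) :=
  (isOpen_discrete {(0 : ZMod (2 ^ 1))}).preimage
    ((continuous_toZModPow 1).comp (continuous_toAdd.comp D.continuous_right))

theorem even_ne_top : D.even ≠ ⊤ := by
  intro h
  have hmem : (SemidirectProduct.inr (Multiplicative.ofAdd 1) : D.Semi) ∈ D.even :=
    h ▸ Subgroup.mem_top _
  rw [mem_even, SemidirectProduct.right_inr, toAdd_ofAdd, map_one] at hmem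
  exact absurd hmem (by decide)

/-- The stabilizer of the point `v` of `V_{i+1}`, on which `(∏ V_i) ⋊ ℤ_2` acts by affine maps. -/
noncomputable def stab (i : ℕ) (v : ZMod (D.p i)) : Subgroup D.Semi where
  carrier := {s | D.coord i s + D.padicChar i s.right * v = v}
  one_mem' := by simp
  mul_mem' := by
    intro s t hs ht
    simp only [Set.mem_ofPred_eq] at hs ht ⊢
    rw [coord_mul, SemidirectProduct.mul_right, map_mul, Units.val_mul]
    conv_rhs => rw [← hs, ← ht]
    ring
  inv_mem' := by
    intro s hs
    simp only [Set.mem_ofPred_eq] at hs ⊢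
    have h : ((D.padicChar i s.right⁻¹ : (ZMod (D.p i))ˣ) : ZMod (D.p i)) *
        D.padicChar i s.right = 1 := by
      rw [← Units.val_mul, ← map_mul, inv_mul_cancel, map_one, Units.val_one]
    rw [coord_inv, SemidirectProduct.inv_right]
    linear_combination
      -((D.padicChar i s.right⁻¹ : (ZMod (D.p i))ˣ) : ZMod (D.p i)) * hs + v * h

theorem mem_stab {i : ℕ} {v : ZMod (D.p i)} {s : D.Semi} :
    s ∈ D.stab i v ↔ D.coord i s + D.padicChar i s.right * v = v := Iff.rfl

theorem mem_stab_zero {i : ℕ} {s : D.Semi} : s ∈ D.stab i 0 ↔ D.coord i s = 0 := by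
  rw [mem_stab, mul_zero, add_zero]

theorem isOpen_stab (i : ℕ) (v : ZMod (D.p i)) : IsOpen (D.stab i v : Set D.Semi) :=
  (isOpen_discrete {v}).preimage ((D.continuous_coord i).add
    (((D.continuous_padicChar i).comp D.continuous_right).mul continuous_const))

/-- Orbit-stabilizer: translations already act transitively on the `p i` points. -/
theorem index_stab (i : ℕ) (v : ZMod (D.p i)) : (D.stab i v).index = D.p i := by
  let _ : MulAction D.Semi (ZMod (D.p i)) :=
    { smul := fun s x => D.coord i s + D.padicChar i s.right * x
      one_smul := fun x => by
        change D.coord i 1 + D.padicChar i (1 : D.Semi).right * x = x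
        simp
      mul_smul := fun s t x => by
        change D.coord i (s * t) + D.padicChar i (s * t).right * x =
          D.coord i s + D.padicChar i s.right * (D.coord i t + D.padicChar i t.right * x)
        rw [coord_mul, SemidirectProduct.mul_right, map_mul, Units.val_mul]
        ring }
  have htrans : MulAction.IsPretransitive D.Semi (ZMod (D.p i)) := ⟨fun x y => by
    refine ⟨SemidirectProduct.inl (Pi.mulSingle i (Multiplicative.ofAdd (y - x))), ?_⟩
    change D.coord i _ + D.padicChar i _ * x = y
    simp⟩
  have h := MulAction.index_stabilizer_of_transitive D.Semi v
  rw [Nat.card_zmod] at h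
  exact h

/-- An affine map of a line over a field that fixes two points is the identity. -/
theorem stab_inf_stab_le {i : ℕ} {v v' : ZMod (D.p i)} (hv : v ≠ v') {s : D.Semi}
    (hs : s ∈ D.stab i v) (hs' : s ∈ D.stab i v') :
    D.coord i s = 0 ∧ D.padicChar i s.right = 1 := by
  rw [mem_stab] at hs hs'
  have h : ((D.padicChar i s.right : ZMod (D.p i)) - 1) * (v - v') = 0 := by
    linear_combination hs - hs'
  have h1 : (D.padicChar i s.right : ZMod (D.p i)) = 1 :=
    sub_eq_zero.1 ((mul_eq_zero.1 h).resolve_right (sub_ne_zero.2 hv))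
  rw [h1] at hs
  exact ⟨by linear_combination hs, Units.ext h1⟩

/-- Translation by `w` carries 0 to `w i` in every `V_i` at once, so a single conjugation normalizes
a whole family of stabilizers. -/
theorem conj_mem_stab {i : ℕ} (w : ∀ i, D.V i) {s : D.Semi} :
    (SemidirectProduct.inl w)⁻¹ * s * SemidirectProduct.inl w ∈ D.stab i 0 ↔
      s ∈ D.stab i (w i).toAdd := by
  rw [mem_stab_zero, mem_stab, coord_mul, coord_mul, coord_inv, SemidirectProduct.mul_right,
    SemidirectProduct.inv_right, SemidirectProduct.right_inl, coord_inl]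
  simp only [inv_one, map_one, Units.val_one, one_mul]
  constructor <;> intro h <;> linear_combination h

/-- The elements of `∏ V_i` with coordinates vanishing outside `T`. -/
def base (T : Set ℕ) : Subgroup D.Semi where
  carrier := {s | s.right = 1 ∧ ∀ j ∉ T, D.coord j s = 0}
  one_mem' := ⟨rfl, fun _ _ => rfl⟩
  mul_mem' := fun {s t} hs ht => ⟨by rw [SemidirectProduct.mul_right, hs.1, ht.1, one_mul],
    fun j hj => by rw [coord_mul, hs.2 j hj, ht.2 j hj, mul_zero, add_zero]⟩
  inv_mem' := fun {s} hs => ⟨by rw [SemidirectProduct.inv_right, hs.1, inv_one],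
    fun j hj => by rw [coord_inv, hs.2 j hj, mul_zero, neg_zero]⟩

instance (T : Set ℕ) : (D.base T).Normal := ⟨fun s hs g => ⟨by
  rw [SemidirectProduct.mul_right, SemidirectProduct.mul_right, hs.1, mul_one,
    SemidirectProduct.inv_right, mul_inv_cancel], fun j hj => by
  rw [D.coord_conj j g hs.1, hs.2 j hj, mul_zero]⟩⟩

theorem inl_mem_base {T : Set ℕ} {w : ∀ i, D.V i} :
    SemidirectProduct.inl w ∈ D.base T ↔ ∀ j ∉ T, w j = 1 :=
  ⟨fun h j hj => h.2 j hj, fun h => ⟨rfl, fun j hj => h j hj⟩⟩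

theorem eq_inl_of_right_eq_one {s : D.Semi} (hs : s.right = 1) :
    s = SemidirectProduct.inl s.left :=
  SemidirectProduct.ext rfl hs

end Choices

end MaxInter
-- Maximal subgroups, generation, supersolvability, subgroups of bounded index
namespace MaxInter

namespace Choices

variable (D : Choices)

attribute [local instance] fact_prime

/-- The natural numbers are dense in `ℤ_2`, and natural multiples correspond to powers. -/
theorem inr_mul_mem {M : Subgroup D.Semi} (hM : IsClosed (M : Set D.Semi)) {z : ℤ_[2]}
    (hz : SemidirectProduct.inr (Multiplicative.ofAdd z) ∈ M) (y : ℤ_[2]) :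
    SemidirectProduct.inr (Multiplicative.ofAdd (y * z)) ∈ M := by
  refine PadicInt.denseRange_natCast.induction_on
    (p := fun y : ℤ_[2] => SemidirectProduct.inr (Multiplicative.ofAdd (y * z)) ∈ M) y ?_ ?_
  · exact hM.preimage (D.continuous_inr.comp
      (continuous_ofAdd.comp (continuous_id.mul continuous_const)))
  · intro k
    rw [← nsmul_eq_mul, ofAdd_nsmul, map_pow]
    exact pow_mem hz k

theorem inr_mem {M : Subgroup D.Semi} (hM : IsClosed (M : Set D.Semi))
    (h : SemidirectProduct.inr (Multiplicative.ofAdd 1) ∈ M) (z : Multiplicative ℤ_[2]) :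
    SemidirectProduct.inr z ∈ M := by
  simpa using D.inr_mul_mem hM h z.toAdd

theorem exists_inl_mem_of_isOpen {M : Subgroup D.Semi} (hM : IsOpen (M : Set D.Semi)) :
    ∃ n, ∀ w : ∀ i, D.V i, (∀ i < n, w i = 1) → SemidirectProduct.inl w ∈ M := by
  obtain ⟨I, u, hu, hsub⟩ := isOpen_pi_iff.1 (hM.preimage D.continuous_inl) 1
    (by simp [one_mem])
  refine ⟨I.sup id + 1, fun w hw => hsub fun i hi => ?_⟩
  rw [hw i (Nat.lt_succ_of_le (Finset.le_sup (f := id) hi))]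
  exact (hu i hi).2

/-- The element of `∏ V_i` that agrees with `w` on the first `n` coordinates and is trivial
elsewhere. -/
def truncate (n : ℕ) (w : ∀ i, D.V i) : ∀ i, D.V i := fun i => if i < n then w i else 1

theorem truncate_succ (n : ℕ) (w : ∀ i, D.V i) :
    D.truncate (n + 1) w = D.truncate n w * Pi.mulSingle n (w n) := by
  funext i
  rw [Pi.mul_apply]
  rcases lt_trichotomy i n with h | rfl | h
  · rw [Pi.mulSingle_eq_of_ne h.ne, mul_one]
    simp [truncate, h, h.trans n.lt_succ_self]
  · simp [truncate]
  · rw [Pi.mulSingle_eq_of_ne h.ne']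
    simp [truncate, h.not_gt, (Nat.succ_le_of_lt h).not_gt]

theorem truncate_inv_mul (n : ℕ) (w : ∀ i, D.V i) {i : ℕ} (hi : i < n) :
    ((D.truncate n w)⁻¹ * w) i = 1 := by
  simp [truncate, hi]

theorem exists_mulSingle_notMem {M : Subgroup D.Semi} (hM : IsOpen (M : Set D.Semi))
    {w : ∀ i, D.V i} (hw : SemidirectProduct.inl w ∉ M) :
    ∃ i, SemidirectProduct.inl (Pi.mulSingle i (w i)) ∉ M := by
  by_contra! hcon
  obtain ⟨n, hn⟩ := D.exists_inl_mem_of_isOpen hM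
  -- A truncation is a finite product of single-coordinate elements, and an open subgroup contains
  -- the remaining tail.
  have htr : ∀ k, SemidirectProduct.inl (D.truncate k w) ∈ M := by
    intro k
    induction k with
    | zero =>
      have : D.truncate 0 w = 1 := funext fun i => by simp [truncate]
      rw [this, map_one]
      exact one_mem _
    | succ k ih =>
      rw [truncate_succ, map_mul]
      exact mul_mem ih (hcon k)
  refine hw ?_
  rw [← mul_inv_cancel_left (D.truncate n w) w, map_mul]
  exact mul_mem (htr n) (hn _ fun i hi => D.truncate_inv_mul n w hi)

/-- A subgroup containing `∏ V_i` is determined by its image in `ℤ_2`. An element outside `even` has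
a 2-adic unit as image, which topologically generates `ℤ_2`. -/
theorem exists_inl_notMem {M : Subgroup D.Semi} (hM : IsOpen (M : Set D.Semi)) (htop : M ≠ ⊤)
    (hE : ¬ M ≤ D.even) : ∃ w, (SemidirectProduct.inl w : D.Semi) ∉ M := by
  by_contra! hcon
  obtain ⟨s, hs, hsE⟩ := SetLike.not_le_iff_exists.1 hE
  have hfac : ∀ t : D.Semi, t ∈ M ↔ SemidirectProduct.inr t.right ∈ M := by
    intro t
    conv_lhs => rw [← SemidirectProduct.inl_left_mul_inr_right t]
    exact Subgroup.mul_mem_cancel_left _ (hcon _)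
  obtain ⟨u, hu⟩ := isUnit_of_toZModPow_one_ne_zero (mt D.mem_even.2 hsE)
  refine htop (eq_top_iff.2 fun t _ => (hfac t).2 ?_)
  have h := D.inr_mul_mem (Subgroup.isClosed_of_isOpen M hM) (z := u)
    (by rw [hu]; exact (hfac s).1 hs) (t.right.toAdd * (u⁻¹ : ℤ_[2]ˣ))
  rwa [mul_assoc, Units.inv_mul, mul_one] at h

theorem zmod_eq_pow {q : ℕ} [Fact q.Prime] {x : Multiplicative (ZMod q)} (hx : x ≠ 1)
    (y : Multiplicative (ZMod q)) : ∃ k : ℕ, y = x ^ k := by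
  have hx' : x.toAdd ≠ 0 := hx
  refine ⟨(y.toAdd / x.toAdd).val, ?_⟩
  rw [← ofAdd_toAdd x, ← ofAdd_nsmul, nsmul_eq_mul, ZMod.natCast_zmod_val, toAdd_ofAdd,
    div_mul_cancel₀ _ hx', ofAdd_toAdd]

theorem mulSingle_mem_of_mem {M : Subgroup D.Semi} {i : ℕ} {x : D.V i} (hx : x ≠ 1)
    (hM : SemidirectProduct.inl (Pi.mulSingle i x) ∈ M) (y : D.V i) :
    SemidirectProduct.inl (Pi.mulSingle i y) ∈ M := by
  obtain ⟨k, rfl⟩ := zmod_eq_pow hx y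
  rw [Pi.mulSingle_pow, map_pow]
  exact pow_mem hM k

theorem exists_pow_eq {k : ℕ} {w : ∀ i, D.V i} (hw : ∀ i, ((k : ZMod (D.p i)) = 0) → w i = 1) :
    ∃ w' : ∀ i, D.V i, w' ^ k = w := by
  refine ⟨fun i => Multiplicative.ofAdd ((k : ZMod (D.p i))⁻¹ * (w i).toAdd), funext fun i => ?_⟩
  rw [Pi.pow_apply, ← ofAdd_nsmul, nsmul_eq_mul]
  by_cases h : (k : ZMod (D.p i)) = 0
  · rw [h, zero_mul, hw i h, ofAdd_zero]
  · rw [mul_inv_cancel_left₀ h, ofAdd_toAdd]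

theorem natCast_ne_zero_of_ne {i j : ℕ} (h : i ≠ j) : ((D.p i : ℕ) : ZMod (D.p j)) ≠ 0 := by
  rw [Ne, ZMod.natCast_eq_zero_iff]
  exact fun hd => h (D.strictMono.injective
    ((Nat.prime_dvd_prime_iff_eq (D.prime j) (D.prime i)).1 hd)).symm

/-- The maximal open subgroups not contained in `(∏ V_i) ⋊ 2ℤ_2` are the stabilizers of points
of the groups `V_i`. -/
theorem exists_eq_stab {M : Subgroup D.Semi} (hopen : IsOpen (M : Set D.Semi)) (hM : IsCoatom M)
    (hE : ¬ M ≤ D.even) : ∃ i v, M = D.stab i v := by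
  obtain ⟨w₀, hw₀⟩ := D.exists_inl_notMem hopen hM.1 hE
  obtain ⟨i, hi⟩ := D.exists_mulSingle_notMem hopen hw₀
  -- `M` misses part of `V_i`, so maximality gives `M V_i = G`: every element enters `M` after a
  -- correction in `V_i`.
  have hsup : M ⊔ D.base {i} = ⊤ := by
    refine hM.2 _ (lt_of_le_of_ne le_sup_left fun h => hi ?_)
    rw [h]
    refine Subgroup.mem_sup_right (D.inl_mem_base.2 fun j hj => Pi.mulSingle_eq_of_ne hj _)
  have hmul : ∀ s : D.Semi, ∃ y : D.V i,
      s * SemidirectProduct.inl (Pi.mulSingle i y) ∈ M := by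
    intro s
    obtain ⟨m, hm, b, hb, rfl⟩ := Subgroup.mem_sup_of_normal_right.1
      (hsup ▸ Subgroup.mem_top s)
    refine ⟨(b.left i)⁻¹, ?_⟩
    have hb' : b = SemidirectProduct.inl (Pi.mulSingle i (b.left i)) := by
      conv_lhs => rw [D.eq_inl_of_right_eq_one hb.1]
      congr 1
      funext j
      by_cases hj : j = i
      · subst hj; simp
      · rw [Pi.mulSingle_eq_of_ne hj]
        exact hb.2 j hj
    rw [Pi.mulSingle_inv, map_inv, ← hb', mul_inv_cancel_right]
    exact hm
  -- `M` contains every other `V_j`: there `p i` is invertible, so `w` is a `p i`-th power, and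
  -- taking that power kills the correction in `V_i`.
  have hW : ∀ w : ∀ j, D.V j, w i = 1 → SemidirectProduct.inl w ∈ M := by
    intro w hw
    obtain ⟨w', rfl⟩ := D.exists_pow_eq (k := D.p i) (w := w) fun j hj => by
      by_cases hij : i = j
      · exact hij ▸ hw
      · exact absurd hj (D.natCast_ne_zero_of_ne hij)
    obtain ⟨y, hy⟩ := hmul (SemidirectProduct.inl w')
    have hyp : y ^ D.p i = 1 := by
      rw [← ofAdd_toAdd y, ← ofAdd_nsmul, nsmul_eq_mul, CharP.cast_eq_zero, zero_mul, ofAdd_zero]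
    have h := pow_mem hy (D.p i)
    rwa [← map_mul, ← map_pow, mul_pow, ← Pi.mulSingle_pow, hyp, Pi.mulSingle_one, mul_one] at h
  obtain ⟨y, hy⟩ := hmul (SemidirectProduct.inr (Multiplicative.ofAdd 1))
  set m := (SemidirectProduct.inr (Multiplicative.ofAdd 1) : D.Semi) *
    SemidirectProduct.inl (Pi.mulSingle i y) with hm
  have hmr : m.right = Multiplicative.ofAdd 1 := by
    rw [hm, SemidirectProduct.mul_right, SemidirectProduct.right_inl, mul_one,
      SemidirectProduct.right_inr]
  have hζ : (1 : ZMod (D.p i)) - D.ζ i ≠ 0 := by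
    intro h
    have h1 : D.ζ i = 1 := Units.ext (sub_eq_zero.1 h).symm
    have ho := D.orderOf_ζ i
    rw [h1, orderOf_one] at ho
    exact (Nat.one_lt_two_pow i.succ_ne_zero).ne ho
  -- The fixed point of `m` on `V_i`, where it acts as `x ↦ coord i m + ζ i * x`.
  set v := D.coord i m / (1 - D.ζ i) with hv
  have hmv : m ∈ D.stab i v := by
    rw [mem_stab, hmr, padicChar_generator, hv]
    field_simp
    ring
  refine ⟨i, v, ?_⟩
  set w : ∀ j, D.V j := Pi.mulSingle i (Multiplicative.ofAdd v) with hw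
  have hwi : (w i).toAdd = v := by rw [hw, Pi.mulSingle_eq_same, toAdd_ofAdd]
  -- Conjugating the fixed point to 0 puts `inr 1`, hence all of `ℤ_2`, in `K`. Together with the
  -- other `V_j` this gives `stab i 0 ≤ K`, that is `stab i v ≤ M`.
  set K : Subgroup D.Semi := M.comap (MulAut.conj (SemidirectProduct.inl w)).toMonoidHom with hK
  have hmemK : ∀ g, (SemidirectProduct.inl w)⁻¹ * g * SemidirectProduct.inl w ∈ K ↔ g ∈ M := by
    intro g
    rw [hK, Subgroup.mem_comap]
    simp [mul_assoc]
  have hKW : ∀ w' : ∀ j, D.V j, w' i = 1 → SemidirectProduct.inl w' ∈ K := by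
    intro w' hw'
    rw [hK, Subgroup.mem_comap, MulEquiv.coe_toMonoidHom, MulAut.conj_apply, ← map_mul, ← map_inv,
      ← map_mul, mul_comm w, mul_inv_cancel_right]
    exact hW w' hw'
  have hfac : ∀ t : D.Semi, D.coord i t = 0 → (t ∈ K ↔ SemidirectProduct.inr t.right ∈ K) := by
    intro t ht
    conv_lhs => rw [← SemidirectProduct.inl_left_mul_inr_right t]
    exact Subgroup.mul_mem_cancel_left _ (hKW _ ht)
  have hKclosed : IsClosed (K : Set D.Semi) :=
    (Subgroup.isClosed_of_isOpen M hopen).preimage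
      ((continuous_const.mul continuous_id).mul continuous_const)
  have h1 : SemidirectProduct.inr (Multiplicative.ofAdd 1) ∈ K := by
    have h0 := (D.conj_mem_stab w (i := i)).2 (hwi.symm ▸ hmv)
    have := (hfac _ (D.mem_stab_zero.1 h0)).1 ((hmemK m).2 hy)
    simpa [hmr] using this
  have hle : D.stab i v ≤ M := by
    intro s hs
    have h0 := (D.conj_mem_stab w (i := i)).2 (hwi.symm ▸ hs)
    exact (hmemK s).1 ((hfac _ (D.mem_stab_zero.1 h0)).2 (D.inr_mem hKclosed h1 _))
  have hco := Subgroup.isCoatom_of_prime_index (M := D.stab i v)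
    (by rw [index_stab]; exact D.prime i)
  exact ((hco.le_iff_eq hM.1).1 hle)

/-- The powers of `(1, 1, …)` are dense in `∏ V_i` by the Chinese remainder theorem, the primes
being distinct. -/
theorem dense_closure :
    Dense (Subgroup.closure {(SemidirectProduct.inl fun _ => Multiplicative.ofAdd 1 : D.Semi),
      SemidirectProduct.inr (Multiplicative.ofAdd 1)} : Set D.Semi) := by
  set a : ∀ i, D.V i := fun _ => Multiplicative.ofAdd 1 with ha
  set C := Subgroup.closure {(SemidirectProduct.inl a : D.Semi),
    SemidirectProduct.inr (Multiplicative.ofAdd 1)} with hC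
  have haC : SemidirectProduct.inl a ∈ C := Subgroup.subset_closure (Set.mem_insert _ _)
  have hxC : SemidirectProduct.inr (Multiplicative.ofAdd 1) ∈ C :=
    Subgroup.subset_closure (Set.mem_insert_of_mem _ rfl)
  have hinr := D.inr_mem C.isClosed_topologicalClosure (C.le_topologicalClosure hxC)
  have hinl : ∀ w, SemidirectProduct.inl w ∈ C.topologicalClosure := by
    intro w
    have hw : w ∈ closure (Set.range fun k : ℕ => a ^ k) := by
      refine mem_closure_iff.2 fun U hU hwU => ?_
      obtain ⟨I, u, hu, hsub⟩ := isOpen_pi_iff.1 hU w hwU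
      obtain ⟨k, hk⟩ := Nat.chineseRemainderOfFinset (fun i => (w i).toAdd.val) D.p I
        (fun i _ => (D.prime i).ne_zero) (fun i _ j _ hij =>
          (Nat.coprime_primes (D.prime i) (D.prime j)).2 (D.strictMono.injective.ne hij))
      refine ⟨a ^ k, hsub fun i hi => ?_, k, rfl⟩
      have h := (ZMod.natCast_eq_natCast_iff _ _ _).2 (hk i hi)
      rw [ZMod.natCast_zmod_val] at h
      have : (a ^ k) i = w i := by
        rw [Pi.pow_apply, ha, ← ofAdd_nsmul, nsmul_one, h, ofAdd_toAdd]
      rw [this]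
      exact (hu i hi).2
    refine map_mem_closure D.continuous_inl hw ?_
    rintro _ ⟨k, rfl⟩
    simp only [map_pow]
    exact pow_mem haC k
  intro s
  rw [← SemidirectProduct.inl_left_mul_inr_right s]
  exact mul_mem (hinl _) (hinr _)

theorem base_Iio_succ (n : ℕ) : D.base (Set.Iio (n + 1)) = D.base (Set.Iio n) ⊔
    Subgroup.zpowers (SemidirectProduct.inl (Pi.mulSingle n (Multiplicative.ofAdd 1))) := by
  apply le_antisymm
  · intro s hs
    have htr : s.left = D.truncate n s.left * Pi.mulSingle n (s.left n) := by
      rw [← truncate_succ]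
      funext i
      by_cases hi : i < n + 1
      · simp [truncate, hi]
      · rw [show s.left i = 1 from hs.2 i hi]; simp [truncate, hi]
    rw [D.eq_inl_of_right_eq_one hs.1, htr, map_mul]
    refine Subgroup.mul_mem_sup ?_ ?_
    · exact D.inl_mem_base.2 fun j hj => if_neg hj
    · exact D.mulSingle_mem_of_mem (x := Multiplicative.ofAdd 1)
        (one_ne_zero (α := ZMod (D.p n))) (Subgroup.mem_zpowers _) _
  · refine sup_le (fun s hs => ⟨hs.1, fun j hj => hs.2 j fun h => hj (h.trans n.lt_succ_self)⟩) ?_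
    rw [Subgroup.zpowers_le, inl_mem_base]
    exact fun j hj => Pi.mulSingle_eq_of_ne (fun h : j = n => hj (h ▸ n.lt_succ_self)) _

theorem base_Iio_zero : D.base (Set.Iio 0) = ⊥ := by
  refine eq_bot_iff.2 fun s hs => D.semi_ext (fun i => hs.2 i (Nat.not_lt_zero i)) hs.1

/-- The open kernel contains all `V_i` with `i ≥ n`. The series adds one cyclic `V_i` at a time, and
the final factor is generated by the image of the generator of `ℤ_2`. -/
theorem isSupersolvable_of_surjective {Q : Type*} [Group Q] (f : D.Semi →* Q)
    (hf : Function.Surjective f) (hker : IsOpen (f.ker : Set D.Semi)) : IsSupersolvable Q := by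
  obtain ⟨n, hn⟩ := D.exists_inl_mem_of_isOpen hker
  refine ⟨n + 1, fun i => if i ≤ n then (D.base (Set.Iio i)).map f else ⊤, ?_, ?_, ?_⟩
  · simp only [Nat.zero_le, if_true, base_Iio_zero, Subgroup.map_bot]
  · simp
  intro i hi
  have hin : i ≤ n := Nat.lt_succ_iff.1 hi
  simp only [if_pos hin]
  refine ⟨Subgroup.Normal.map inferInstance f hf, ?_⟩
  rcases hin.lt_or_eq with hlt | rfl
  · refine ⟨f (SemidirectProduct.inl (Pi.mulSingle i (Multiplicative.ofAdd 1))), ?_⟩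
    rw [if_pos (Nat.succ_le_of_lt hlt), base_Iio_succ, Subgroup.map_sup, MonoidHom.map_zpowers]
  · refine ⟨f (SemidirectProduct.inr (Multiplicative.ofAdd 1)), ?_⟩
    rw [if_neg (Nat.not_succ_le_self i)]
    symm
    set S := (D.base (Set.Iio i)).map f ⊔
      Subgroup.zpowers (f (SemidirectProduct.inr (Multiplicative.ofAdd 1))) with hS
    have hkerle : f.ker ≤ S.comap f := fun s hs => by
      rw [Subgroup.mem_comap, MonoidHom.mem_ker.1 hs]
      exact one_mem _
    have hinr := D.inr_mem (Subgroup.isClosed_of_isOpen _ (Subgroup.isOpen_mono hkerle hker))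
      (Subgroup.mem_comap.2 (Subgroup.mem_sup_right (Subgroup.mem_zpowers _)))
    refine eq_top_iff.2 fun q _ => ?_
    obtain ⟨s, rfl⟩ := hf q
    rw [← Subgroup.mem_comap, ← SemidirectProduct.inl_left_mul_inr_right s]
    refine mul_mem ?_ (hinr _)
    rw [← mul_inv_cancel_left (D.truncate i s.left) s.left, map_mul]
    refine mul_mem (Subgroup.mem_sup_left (Subgroup.mem_map_of_mem _ ?_))
      (hkerle (hn _ fun j hj => D.truncate_inv_mul i s.left hj))
    exact D.inl_mem_base.2 fun j hj => if_neg hj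

/-- A subgroup of index at most `n` contains all `n!`-th powers. Elements whose coordinates vanish
for `i ≤ n` and whose 2-adic part is divisible by `n!` are products of two such powers, and they
contain a neighbourhood of 1. -/
theorem exists_open_le_of_index_le (n : ℕ) :
    ∃ K : Subgroup D.Semi, IsOpen (K : Set D.Semi) ∧
      ∀ L : Subgroup D.Semi, IsOpen (L : Set D.Semi) → L.index ≠ 0 → L.index ≤ n → K ≤ L := by
  obtain ⟨k, hk⟩ := exists_dvd_of_toZModPow_eq_zero (d := (n.factorial : ℤ_[2]))
    (Nat.cast_ne_zero.2 n.factorial_ne_zero)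
  set U : Set D.Semi := {s | PadicInt.toZModPow k s.right.toAdd = 0} ∩
    ⋂ i ∈ Finset.range (n + 1), {s | D.coord i s = 0} with hU
  have hUopen : IsOpen U := by
    refine IsOpen.inter ?_ (isOpen_biInter_finset fun i _ => ?_)
    · exact (isOpen_discrete {(0 : ZMod (2 ^ k))}).preimage
        ((continuous_toZModPow k).comp (continuous_toAdd.comp D.continuous_right))
    · exact (isOpen_discrete {(0 : ZMod (D.p i))}).preimage (D.continuous_coord i)
  refine ⟨Subgroup.closure U, ?_, fun L hL h0 hn => (Subgroup.closure_le L).2 ?_⟩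
  · refine Subgroup.isOpen_of_mem_nhds _ (g := 1)
      (mem_of_superset (hUopen.mem_nhds ?_) Subgroup.subset_closure)
    simp [hU]
  · rintro s ⟨hs, hs'⟩
    have hpow : ∀ g : D.Semi, g ^ n.factorial ∈ L := by
      intro g
      obtain ⟨j, hj, hjn, hg⟩ := Subgroup.exists_pow_mem_of_index_ne_zero h0 g
      obtain ⟨c, hc⟩ := Nat.dvd_factorial hj (hjn.trans hn)
      rw [hc, pow_mul]
      exact pow_mem hg c
    rw [SetLike.mem_coe, ← SemidirectProduct.inl_left_mul_inr_right s]
    refine mul_mem ?_ ?_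
    · obtain ⟨w', hw'⟩ := D.exists_pow_eq (k := n.factorial) (w := s.left) fun i hi => by
        rw [ZMod.natCast_eq_zero_iff, (D.prime i).dvd_factorial] at hi
        -- Only primes `p i ≤ n` obstruct division by `n!`, and `i ≤ p i`.
        have : i ≤ n := (D.strictMono.id_le i).trans hi
        exact Set.mem_iInter₂.1 hs' i (Finset.mem_range_succ_iff.2 this)
      rw [← hw', map_pow]
      exact hpow _
    · obtain ⟨c, hc⟩ := hk _ hs
      have : s.right = Multiplicative.ofAdd c ^ n.factorial := by
        rw [← ofAdd_nsmul, nsmul_eq_mul, ← hc, ofAdd_toAdd]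
      rw [this, map_pow]
      exact hpow _

end Choices

end MaxInter
-- Counting conjugacy classes
namespace MaxInter

theorem conjClass_eq {G : Type*} [Group G] [TopologicalSpace G] {H K : OpenSubgroup G} {g : G}
    (h : (H : Subgroup G) = MulAut.conj g • (K : Subgroup G)) : conjClass H = conjClass K := by
  ext L
  constructor
  · rintro ⟨x, hx⟩
    exact ⟨x * g, by rw [hx, h, smul_smul, ← map_mul]⟩
  · rintro ⟨x, hx⟩
    exact ⟨x * g⁻¹, by rw [hx, h, smul_smul, ← map_mul, inv_mul_cancel_right]⟩

theorem index_finset_inf_le {G ι : Type*} [Group G] [TopologicalSpace G] (s : Finset ι)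
    (f : ι → OpenSubgroup G) :
    ((s.inf f : OpenSubgroup G) : Subgroup G).index ≤ ∏ i ∈ s, (f i : Subgroup G).index := by
  classical
  induction s using Finset.induction_on with
  | empty => simp
  | insert a s has ih =>
    rw [Finset.inf_insert, Finset.prod_insert has, OpenSubgroup.toSubgroup_inf]
    exact Subgroup.index_inf_le.trans (Nat.mul_le_mul_left _ ih)

theorem index_ne_zero_of_isOpen {G : Type*} [Group G] [TopologicalSpace G] [IsTopologicalGroup G]
    [CompactSpace G] (H : OpenSubgroup G) : (H : Subgroup G).index ≠ 0 := by
  have : Finite (G ⧸ H.toSubgroup) := H.toSubgroup.quotient_finite_of_isOpen H.isOpen'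
  exact Subgroup.index_ne_zero_of_finite

theorem index_le_index {G : Type*} [Group G] [TopologicalSpace G] [IsTopologicalGroup G]
    [CompactSpace G] {H K : OpenSubgroup G} (h : H ≤ K) :
    (K : Subgroup G).index ≤ (H : Subgroup G).index :=
  Nat.le_of_dvd (Nat.pos_of_ne_zero (index_ne_zero_of_isOpen H))
    (Subgroup.index_dvd_of_le (show (H : Subgroup G) ≤ K from h))

namespace Choices

variable (D : Choices)

attribute [local instance] fact_prime

/-- The isomorphism from the inverse limit of the groups `G_n` to `(∏ V_i) ⋊ ℤ_2`. -/
noncomputable def toSemi : D.G →* D.Semi := D.semiEquiv.symm.toMulEquiv.toMonoidHom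

theorem continuous_toSemi : Continuous D.toSemi := D.semiEquiv.symm.continuous

theorem toSemi_semiEquiv (s : D.Semi) : D.toSemi (D.semiEquiv s) = s :=
  D.semiEquiv.symm_apply_apply s

theorem toSemi_surjective : Function.Surjective D.toSemi := D.semiEquiv.symm.surjective

/-- The open subgroup of the inverse limit that corresponds to `stab i v`. -/
noncomputable def stabG (i : ℕ) (v : ZMod (D.p i)) : OpenSubgroup D.G :=
  ⟨(D.stab i v).comap D.toSemi, (D.isOpen_stab i v).preimage D.continuous_toSemi⟩

/-- The open subgroup of the inverse limit that corresponds to `even`. -/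
noncomputable def evenG : OpenSubgroup D.G :=
  ⟨D.even.comap D.toSemi, D.isOpen_even.preimage D.continuous_toSemi⟩

theorem mem_stabG {i : ℕ} {v : ZMod (D.p i)} {g : D.G} :
    g ∈ D.stabG i v ↔ D.toSemi g ∈ D.stab i v := Iff.rfl

theorem mem_evenG {g : D.G} : g ∈ D.evenG ↔ D.toSemi g ∈ D.even := Iff.rfl

theorem index_stabG (i : ℕ) (v : ZMod (D.p i)) : (D.stabG i v : Subgroup D.G).index = D.p i :=
  (Subgroup.index_comap_of_surjective _ D.toSemi_surjective).trans (D.index_stab i v)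

theorem isCoatom_stabG (i : ℕ) (v : ZMod (D.p i)) : IsCoatom (D.stabG i v) :=
  isCoatom_of_prime_index (by rw [index_stabG]; exact D.prime i)

theorem evenG_ne_top : D.evenG ≠ ⊤ := by
  intro h
  refine D.even_ne_top (eq_top_iff.2 fun s _ => ?_)
  have : D.semiEquiv s ∈ D.evenG := h ▸ OpenSubgroup.mem_top _
  rwa [mem_evenG, toSemi_semiEquiv] at this

theorem exists_eq_stabG {M : OpenSubgroup D.G} (hM : IsCoatom M) (hE : ¬ M ≤ D.evenG) :
    ∃ i v, M = D.stabG i v := by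
  set L : Subgroup D.Semi := D.semiEquiv.symm.toMulEquiv.mapSubgroup (M : Subgroup D.G) with hL
  have hmem : ∀ s, s ∈ L ↔ D.semiEquiv s ∈ M := by
    intro s
    constructor
    · rintro ⟨g, hg, rfl⟩
      have : D.semiEquiv (D.semiEquiv.symm g) = g := D.semiEquiv.apply_symm_apply g
      exact this.symm ▸ hg
    · exact fun h => ⟨_, h, D.semiEquiv.symm_apply_apply s⟩
  have hmem' : ∀ g, g ∈ M ↔ D.toSemi g ∈ L := by
    intro g
    rw [hmem]
    exact (congrArg (· ∈ M) (D.semiEquiv.apply_symm_apply g)).to_iff.symm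
  have hopen : IsOpen (L : Set D.Semi) := by
    convert M.isOpen.preimage D.semiEquiv.continuous
    ext s
    exact hmem s
  obtain ⟨i, v, h⟩ := D.exists_eq_stab hopen
    ((OrderIso.isCoatom_iff _ _).2 (isCoatom_toSubgroup hM))
    (fun hle => hE fun g hg => hle ((hmem' g).1 hg))
  exact ⟨i, v, OpenSubgroup.ext fun g => by rw [hmem', h, mem_stabG]⟩

theorem stabG_inf_stabG_le {i : ℕ} {v v' : ZMod (D.p i)} (hv : v ≠ v') :
    D.stabG i v ⊓ D.stabG i v' ≤ D.evenG := fun _ hg =>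
  D.mem_even.2 (toZModPow_one_eq_zero _
    (D.padicChar_eq_one_iff.1 (D.stab_inf_stab_le hv hg.1 hg.2).2))

/-- The intersection of the stabilizers of the points `0` of the `V_i` with `i ∈ C`. -/
noncomputable def stabs (C : Finset ℕ) : OpenSubgroup D.G := C.inf fun i => D.stabG i 0

theorem mem_stabs {C : Finset ℕ} {g : D.G} :
    g ∈ D.stabs C ↔ ∀ i ∈ C, D.coord i (D.toSemi g) = 0 := by
  rw [← SetLike.mem_coe, stabs, OpenSubgroup.coe_finset_inf, Set.mem_iInter₂]
  exact forall₂_congr fun i _ => D.mem_stab_zero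

theorem mem_conj_stabs {C : Finset ℕ} (w : ∀ i, D.V i) {g : D.G} :
    g ∈ MulAut.conj (D.semiEquiv (SemidirectProduct.inl w)) • (D.stabs C : Subgroup D.G) ↔
      ∀ i ∈ C, g ∈ D.stabG i (w i).toAdd := by
  rw [Subgroup.mem_pointwise_smul_iff_inv_smul_mem, ← map_inv, MulAut.smul_def, MulAut.conj_apply,
    inv_inv]
  refine D.mem_stabs.trans (forall₂_congr fun i _ => ?_)
  rw [map_mul, map_mul, map_inv, toSemi_semiEquiv, ← mem_stab_zero, conj_mem_stab, mem_stabG]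

theorem conj_evenG (g : D.G) :
    MulAut.conj g • (D.evenG : Subgroup D.G) = (D.evenG : Subgroup D.G) := by
  have : (D.evenG : Subgroup D.G).Normal := Subgroup.Normal.comap inferInstance D.toSemi
  exact Subgroup.Normal.conj_smul_eq_self g _

/-- An intersection of maximal subgroups that is not contained in `(∏ V_i) ⋊ 2ℤ_2` is conjugate to
an intersection of stabilizers of points `0`. -/
theorem exists_eq_conj_stabs {N : ℕ} {X : OpenSubgroup D.G} (hX : IsMaximalIntersection X)
    (hE : ¬ X ≤ D.evenG) (hindex : (X : Subgroup D.G).index < D.p N) :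
    ∃ C ∈ (Finset.range N).powerset, ∃ g : D.G,
      (X : Subgroup D.G) = MulAut.conj g • (D.stabs C : Subgroup D.G) := by
  classical
  obtain ⟨S, hS, hXS⟩ := hX
  have hle : ∀ M ∈ S, X ≤ M := fun M hM g hg => by
    have hg' : g ∈ (X : Set D.G) := hg
    rw [hXS] at hg'
    exact Set.mem_iInter₂.1 hg' M hM
  have huniq : ∀ i v v', D.stabG i v ∈ S → D.stabG i v' ∈ S → v = v' := by
    intro i v v' hv hv'
    by_contra hne
    exact hE ((le_inf (hle _ hv) (hle _ hv')).trans (D.stabG_inf_stabG_le hne))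
  -- The only point of `V_i` whose stabilizer can occur in `S`; 0 serves as default when none
  -- occurs.
  have hw : ∀ i, ∃ v, ∀ v', D.stabG i v' ∈ S → v' = v := by
    intro i
    by_cases h : ∃ v, D.stabG i v ∈ S
    · obtain ⟨v, hv⟩ := h
      exact ⟨v, fun v' hv' => huniq i v' v hv' hv⟩
    · exact ⟨0, fun v' hv' => absurd ⟨v', hv'⟩ h⟩
  choose w hw using hw
  refine ⟨(Finset.range N).filter fun i => D.stabG i (w i) ∈ S,
    Finset.mem_powerset.2 (Finset.filter_subset _ _),
    D.semiEquiv (SemidirectProduct.inl fun i => Multiplicative.ofAdd (w i)), ?_⟩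
  refine SetLike.ext fun g => ?_
  rw [mem_conj_stabs]
  constructor
  · intro hg i hi
    exact hle _ (Finset.mem_filter.1 hi).2 hg
  · intro hg
    have : g ∈ (X : Set D.G) := by
      rw [hXS]
      refine Set.mem_iInter₂.2 fun M hM => ?_
      obtain ⟨i, v, rfl⟩ := D.exists_eq_stabG (hS M hM) fun h => hE ((hle M hM).trans h)
      obtain rfl := hw i v hM
      refine hg i (Finset.mem_filter.2 ⟨Finset.mem_range.2 ?_, hM⟩)
      -- A stabilizer containing `X` has index `p i < p N`, which forces `i < N`.
      have hlt := (index_le_index (hle _ hM)).trans_lt hindex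
      rw [index_stabG] at hlt
      exact D.strictMono.lt_iff_lt.1 hlt
    exact this

/-- Weisner's alternative at `evenG` supplies one bit and the conjugacy normal form a subset of
`range N`. As `evenG` is normal, conjugating `X` also normalizes `X ⊓ evenG`. -/
theorem betaTilde_le {n N : ℕ} (hn : n < D.p N) : betaTilde D.G n ≤ 2 ^ (N + 1) := by
  classical
  let F : Finset ℕ × Bool → Set (OpenSubgroup D.G) := fun q =>
    conjClass (if q.2 then D.stabs q.1 ⊓ D.evenG else D.stabs q.1)
  have hsub : conjClass '' {H : OpenSubgroup D.G | (H : Subgroup D.G).index ≤ n ∧ moebius H ≠ 0} ⊆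
      (((Finset.range N).powerset ×ˢ Finset.univ).image F : Finset _) := by
    rintro _ ⟨H, ⟨hHn, hH⟩, rfl⟩
    obtain ⟨X, hX, hE, hHX⟩ := exists_isMaximalIntersection_of_moebius_ne_zero D.evenG_ne_top hH
    have hHle : H ≤ X := by
      rcases hHX with rfl | rfl
      · exact le_rfl
      · exact inf_le_left
    obtain ⟨C, hC, g, hg⟩ := D.exists_eq_conj_stabs hX hE
      (((index_le_index hHle).trans hHn).trans_lt hn)
    have hmem : ∀ {C}, C ∈ (Finset.range N).powerset → ∀ b : Bool,
        (C, b) ∈ (((Finset.range N).powerset ×ˢ Finset.univ : Finset (Finset ℕ × Bool)) :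
          Set (Finset ℕ × Bool)) := fun hC b =>
      Finset.mem_coe.2 <| Finset.mem_product.2 ⟨hC, Finset.mem_univ b⟩
    rw [Finset.coe_image]
    rcases hHX with rfl | rfl
    · exact ⟨(C, false), hmem hC _, (conjClass_eq hg).symm⟩
    · refine ⟨(C, true), hmem hC _, (conjClass_eq (g := g) ?_).symm⟩
      rw [if_pos rfl, OpenSubgroup.toSubgroup_inf, OpenSubgroup.toSubgroup_inf, Subgroup.smul_inf,
        D.conj_evenG, hg]
  calc betaTilde D.G n ≤ _ := Set.ncard_le_ncard hsub (Finset.finite_toSet _)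
    _ = _ := Set.ncard_coe_finset _
    _ ≤ _ := Finset.card_image_le
    _ = 2 ^ (N + 1) := by simp [pow_succ]

theorem finite_index_le (n : ℕ) :
    {H : OpenSubgroup D.G | (H : Subgroup D.G).index ≤ n}.Finite := by
  obtain ⟨K, hK, hKle⟩ := D.exists_open_le_of_index_le n
  refine (finite_Icc_openSubgroup D.G
    ⟨K.comap D.toSemi, hK.preimage D.continuous_toSemi⟩ ⊤).subset fun H hH => ⟨?_, le_top⟩
  have hcomap : ((H : Subgroup D.G).comap D.semiEquiv.toMulEquiv.toMonoidHom).index =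
      (H : Subgroup D.G).index := Subgroup.index_comap_of_surjective _ D.semiEquiv.surjective
  have h := hKle ((H : Subgroup D.G).comap D.semiEquiv.toMulEquiv.toMonoidHom)
    (H.isOpen.preimage D.semiEquiv.continuous) (hcomap ▸ index_ne_zero_of_isOpen H)
    (hcomap.trans_le hH)
  intro g hg
  have := h hg
  rw [Subgroup.mem_comap] at this
  exact (D.semiEquiv.apply_symm_apply g) ▸ this

/-- The intersection of `stabs C` with the stabilizer of a second point of `V_t`. -/
noncomputable def twoPoints (t : ℕ) (C : Finset ℕ) : OpenSubgroup D.G := D.stabs C ⊓ D.stabG t 1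

theorem isMaximalIntersection_twoPoints (t : ℕ) (C : Finset ℕ) :
    IsMaximalIntersection (D.twoPoints t C) := by
  refine ⟨insert (D.stabG t 1) ((fun i => D.stabG i 0) '' (C : Set ℕ)), ?_, ?_⟩
  · rintro M (rfl | ⟨i, -, rfl⟩)
    · exact D.isCoatom_stabG _ _
    · exact D.isCoatom_stabG _ _
  · rw [Set.biInter_insert, Set.biInter_image, twoPoints, OpenSubgroup.coe_inf, stabs,
      OpenSubgroup.coe_finset_inf, Set.inter_comm]
    rfl

/-- Fixing both 0 and 1 in `V_t` makes the character trivial, and it is faithful modulo `2 ^ (t +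
1)`. -/
theorem mem_twoPoints {t : ℕ} {C : Finset ℕ} (ht : t ∈ C) {g : D.G} :
    g ∈ D.twoPoints t C ↔ (∀ i ∈ C, D.coord i (D.toSemi g) = 0) ∧
      PadicInt.toZModPow (t + 1) (D.toSemi g).right.toAdd = 0 := by
  change g ∈ D.stabs C ∧ D.toSemi g ∈ D.stab t 1 ↔ _
  rw [mem_stabs]
  refine and_congr_right fun h => ?_
  rw [← D.padicChar_eq_one_iff (i := t)]
  constructor
  · exact fun h1 => (D.stab_inf_stab_le zero_ne_one (D.mem_stab_zero.2 (h t ht)) h1).2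
  · intro h1
    rw [mem_stab, h t ht, h1, Units.val_one, mul_one, zero_add]

theorem index_twoPoints_le {t : ℕ} {C : Finset ℕ} (ht : t ∈ C) :
    (D.twoPoints t C : Subgroup D.G).index ≤ 2 ^ (t + 1) * ∏ i ∈ C, D.p i := by
  let f : D.G →* H (t + 1) := ((AddMonoidHom.toMultiplicative
    (PadicInt.toZModPow (p := 2) (t + 1)).toAddMonoidHom).comp
      SemidirectProduct.rightHom).comp D.toSemi
  have heq : (D.twoPoints t C : Subgroup D.G) = f.ker ⊓ (D.stabs C : Subgroup D.G) := by
    refine SetLike.ext fun g => (D.mem_twoPoints ht).trans ?_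
    rw [and_comm, ← mem_stabs]
    exact Iff.rfl
  have hf : f.ker.index ≤ 2 ^ (t + 1) := by
    rw [Subgroup.index_ker]
    refine (Nat.card_le_card_of_injective _ Subtype.val_injective).trans_eq ?_
    rw [Nat.card_congr Multiplicative.toAdd, Nat.card_zmod]
  rw [heq]
  refine Subgroup.index_inf_le.trans (Nat.mul_le_mul hf ((index_finset_inf_le _ _).trans_eq ?_))
  exact Finset.prod_congr rfl fun i _ => D.index_stabG i 0

/-- Conjugation keeps the 2-adic part and rescales vectors of `∏ V_i`. So the 2-adic number `2 ^ (t
+ 1)` detects `t`, and a unit vector of `V_i` detects whether `i ∈ C`. -/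
theorem le_and_subset_of_twoPoints_eq_conj {t t' : ℕ} {C C' : Finset ℕ} (ht : t ∈ C)
    (ht' : t' ∈ C') {g : D.G} (h : (D.twoPoints t C : Subgroup D.G) =
      MulAut.conj g • (D.twoPoints t' C' : Subgroup D.G)) : t' ≤ t ∧ C' ⊆ C := by
  have hconj : ∀ s : D.Semi, D.semiEquiv s ∈ D.twoPoints t C →
      D.semiEquiv ((D.toSemi g)⁻¹ * s * D.toSemi g) ∈ D.twoPoints t' C' := by
    intro s hs
    have hs' : D.semiEquiv s ∈ (D.twoPoints t C : Subgroup D.G) := hs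
    rw [h, Subgroup.mem_pointwise_smul_iff_inv_smul_mem, ← map_inv, MulAut.smul_def,
      MulAut.conj_apply, inv_inv] at hs'
    have hg : D.semiEquiv (D.toSemi g) = g := D.semiEquiv.apply_symm_apply g
    rw [map_mul, map_mul, map_inv, hg]
    exact hs'
  constructor
  · have h1 := hconj (SemidirectProduct.inr (Multiplicative.ofAdd ((2 : ℤ_[2]) ^ (t + 1)))) (by
      rw [mem_twoPoints _ ht, toSemi_semiEquiv]
      refine ⟨fun i _ => D.coord_inr i _, ?_⟩
      rw [SemidirectProduct.right_inr, toAdd_ofAdd, ← RingHom.mem_ker, PadicInt.ker_toZModPow]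
      exact Ideal.mem_span_singleton_self _)
    have h2 := ((D.mem_twoPoints ht').1 h1).2
    rw [toSemi_semiEquiv, SemidirectProduct.mul_right, SemidirectProduct.mul_right,
      SemidirectProduct.inv_right, SemidirectProduct.right_inr, mul_comm, mul_inv_cancel_left,
      toAdd_ofAdd, map_pow, map_ofNat] at h2
    have h3 : ((2 ^ (t + 1) : ℕ) : ZMod (2 ^ (t' + 1))) = 0 := by exact_mod_cast h2
    rw [ZMod.natCast_eq_zero_iff, Nat.pow_dvd_pow_iff_le_right'] at h3
    omega
  · intro i hi
    by_contra hiC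
    have h1 := hconj (SemidirectProduct.inl (Pi.mulSingle i (Multiplicative.ofAdd 1))) (by
      rw [mem_twoPoints _ ht, toSemi_semiEquiv]
      refine ⟨fun j hj => ?_, ?_⟩
      · rw [coord_inl, Pi.mulSingle_eq_of_ne (fun e : j = i => hiC (e ▸ hj)), toAdd_one]
      · rw [SemidirectProduct.right_inl, toAdd_one, map_zero])
    have h2 := ((D.mem_twoPoints ht').1 h1).1 i hi
    have h3 := D.coord_conj i (D.toSemi g)⁻¹
      (s := SemidirectProduct.inl (Pi.mulSingle i (Multiplicative.ofAdd 1))) rfl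
    rw [inv_inv] at h3
    rw [toSemi_semiEquiv, h3, coord_inl, Pi.mulSingle_eq_same, toAdd_ofAdd, mul_one] at h2
    exact Units.ne_zero _ h2

theorem twoPoints_injOn {t t' : ℕ} {C C' : Finset ℕ} (ht : t ∈ C) (ht' : t' ∈ C')
    (h : conjClass (D.twoPoints t C) = conjClass (D.twoPoints t' C')) : t = t' ∧ C = C' := by
  have hself : ∀ H : OpenSubgroup D.G, H ∈ conjClass H := fun H => ⟨1, by simp⟩
  obtain ⟨g, hg⟩ := h ▸ hself (D.twoPoints t C)
  obtain ⟨g', hg'⟩ := h.symm ▸ hself (D.twoPoints t' C')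
  obtain ⟨h1, h2⟩ := D.le_and_subset_of_twoPoints_eq_conj ht ht' hg
  obtain ⟨h3, h4⟩ := D.le_and_subset_of_twoPoints_eq_conj ht' ht hg'
  exact ⟨le_antisymm h3 h1, h4.antisymm h2⟩

theorem le_gammaTilde (N : ℕ) :
    N * 2 ^ (N - 1) ≤ gammaTilde D.G (2 ^ N * ∏ i ∈ Finset.range N, D.p i) := by
  classical
  -- Pairs of `t` and `C ∖ {t}`: `N` choices of `t`, then `2 ^ (N - 1)` subsets.
  set A := (Finset.range N).sigma fun t => ((Finset.range N).erase t).powerset with hA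
  let F : (Σ _ : ℕ, Finset ℕ) → Set (OpenSubgroup D.G) := fun q =>
    conjClass (D.twoPoints q.1 (insert q.1 q.2))
  have hinj : Set.InjOn F A := by
    rintro ⟨t, C⟩ hq ⟨t', C'⟩ hq' h
    simp only [hA, Finset.coe_sigma, Set.mem_sigma_iff, Finset.mem_coe,
      Finset.mem_powerset] at hq hq'
    obtain ⟨rfl, hC⟩ := D.twoPoints_injOn (Finset.mem_insert_self _ _)
      (Finset.mem_insert_self _ _) h
    have hnot : ∀ C ⊆ (Finset.range N).erase t, t ∉ C := fun C hC ht =>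
      Finset.notMem_erase t _ (hC ht)
    rw [← Finset.erase_insert (hnot C hq.2), ← Finset.erase_insert (hnot C' hq'.2), hC]
  have hcard : (A.image F).card = N * 2 ^ (N - 1) := by
    rw [Finset.card_image_of_injOn hinj, hA, Finset.card_sigma, Finset.sum_congr rfl fun t ht => by
      rw [Finset.card_powerset, Finset.card_erase_of_mem ht, Finset.card_range]]
    simp
  rw [← hcard, ← Set.ncard_coe_finset]
  -- An infinite set would have `ncard` 0, so finiteness of the set counted by `gammaTilde` is
  -- essential here.
  refine Set.ncard_le_ncard ?_
    (((D.finite_index_le _).subset fun H hH => hH.1).image conjClass)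
  rw [Finset.coe_image]
  rintro _ ⟨⟨t, C⟩, hq, rfl⟩
  simp only [hA, Finset.coe_sigma, Set.mem_sigma_iff, Finset.mem_coe, Finset.mem_powerset,
    Finset.mem_range] at hq
  refine ⟨_, ⟨(D.index_twoPoints_le (Finset.mem_insert_self _ _)).trans ?_,
    D.isMaximalIntersection_twoPoints _ _⟩, rfl⟩
  refine Nat.mul_le_mul (Nat.pow_le_pow_right two_pos hq.1)
    (Finset.prod_le_prod_of_subset_of_one_le' ?_ fun i _ _ => (D.prime i).one_le)
  exact Finset.insert_subset (Finset.mem_range.2 hq.1)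
    (hq.2.trans (Finset.erase_subset _ _))

theorem betaTilde_div_gammaTilde_le (N : ℕ) :
    (betaTilde D.G (2 ^ (N + 1) * ∏ i ∈ Finset.range (N + 1), D.p i) : ℝ≥0∞) /
      gammaTilde D.G (2 ^ (N + 1) * ∏ i ∈ Finset.range (N + 1), D.p i) ≤ 4 / (N + 1 : ℕ) := by
  -- The same index bound admits all two-point subgroups on the first `N + 1` primes, yet stays
  -- below the next prime.
  have hβ := D.betaTilde_le (D.growth N)
  have hγ := D.le_gammaTilde (N + 1)
  rw [Nat.add_sub_cancel] at hγ
  refine (ENNReal.div_le_div (Nat.cast_le.2 hβ) (Nat.cast_le.2 hγ)).trans_eq ?_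
  rw [show 2 ^ (N + 1 + 1) = 4 * 2 ^ N by ring, Nat.cast_mul, Nat.cast_mul]
  exact ENNReal.mul_div_mul_right _ _ (by simp) (by simp)

theorem liminf_eq_zero :
    liminf (fun n : ℕ => (betaTilde D.G n : ℝ≥0∞) / (gammaTilde D.G n : ℝ≥0∞)) atTop = 0 := by
  have hlim : Tendsto (fun k : ℕ => (4 : ℝ≥0∞) / k) atTop (𝓝 0) := by
    have := ENNReal.Tendsto.const_div (a := 4) ENNReal.tendsto_nat_nhds_top (Or.inr (by simp))
    simpa using this
  refine le_antisymm (ge_of_tendsto' hlim fun k => ?_) bot_le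
  refine liminf_le_of_frequently_le (frequently_atTop.2 fun a => ?_)
  -- Taking `max a k` makes the index bound at least `a` and the ratio at most `4 / k`.
  refine ⟨_, ?_, (D.betaTilde_div_gammaTilde_le (max a k)).trans ?_⟩
  · refine (le_max_left a k).trans ((Nat.le_succ _).trans (Nat.lt_two_pow_self.le.trans
      (Nat.le_mul_of_pos_right _ (Finset.prod_pos fun i _ => (D.prime i).pos))))
  · exact ENNReal.div_le_div le_rfl (Nat.cast_le.2 ((le_max_right a k).trans (Nat.le_succ _)))

theorem isProsupersolvable : IsProsupersolvable D.G where
  isTopologicalGroup := inferInstance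
  compactSpace := inferInstance
  t2Space := inferInstance
  totallyDisconnectedSpace := inferInstance
  supersolvable_quotient N := by
    refine D.isSupersolvable_of_surjective
      ((QuotientGroup.mk' N.toSubgroup).comp D.semiEquiv.toMulEquiv.toMonoidHom)
      ((QuotientGroup.mk'_surjective _).comp D.semiEquiv.surjective) ?_
    rw [← MonoidHom.comap_ker, QuotientGroup.ker_mk']
    exact N.isOpen'.preimage D.semiEquiv.continuous

theorem isTwoGenerated : IsTwoGenerated D.G := by
  refine ⟨D.semiEquiv (SemidirectProduct.inl fun _ => Multiplicative.ofAdd 1),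
    D.semiEquiv (SemidirectProduct.inr (Multiplicative.ofAdd 1)), ?_⟩
  have h := D.semiEquiv.surjective.denseRange.dense_image D.semiEquiv.continuous D.dense_closure
  have himage : (D.semiEquiv.toMulEquiv.toMonoidHom '' (Subgroup.closure
      {(SemidirectProduct.inl fun _ => Multiplicative.ofAdd 1 : D.Semi),
        SemidirectProduct.inr (Multiplicative.ofAdd 1)} : Set D.Semi)) =
      Subgroup.closure {D.semiEquiv (SemidirectProduct.inl fun _ => Multiplicative.ofAdd 1),
        D.semiEquiv (SemidirectProduct.inr (Multiplicative.ofAdd 1))} := by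
    rw [← Subgroup.coe_map, MonoidHom.map_closure, Set.image_pair]
    rfl
  rw [← himage]
  exact h

end Choices

end MaxInter

theorem mainTheorem10 :
    Nonempty MaxInter.Choices ∧
    ∀ D : MaxInter.Choices,
      MaxInter.IsProsupersolvable D.G ∧
      MaxInter.IsTwoGenerated D.G ∧
      Nonempty (D.G ≃ₜ* D.Semi) ∧
      (∀ n : ℕ, {H : OpenSubgroup D.G | (H : Subgroup D.G).index ≤ n}.Finite) ∧
      liminf (fun n : ℕ =>
        (MaxInter.betaTilde D.G n : ℝ≥0∞) / (MaxInter.gammaTilde D.G n : ℝ≥0∞)) atTop = 0 :=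
  ⟨MaxInter.Choices.nonempty, fun D => ⟨D.isProsupersolvable, D.isTwoGenerated,
    ⟨D.semiEquiv.symm⟩, D.finite_index_le, D.liminf_eq_zero⟩⟩
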